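/- Let $N,T\ge 1$, and let indices of vectors of length $M$ be taken modulo $M$. **DFT and DFRT.** Let $\mathbf F$ be the normalized DFT matrix, $\mathbf F_{m,n}=\tfrac1{\sqrt M}e^{-2\pi j mn/M}$, of size $M=N$ or $M=T$. For $0\le k\le M$, $k\ne M-1+(M \bmod 2)$, let $\mathbf u_k\in\mathbb R^M$ be the $k$-th discrete Hermite–Gaussian: the unit eigenvector, unique up to sign, of $(Sf)(m)=f(m+1)+f(m-1)+(2\cos(2\pi m/M)-4)f(m)$ which has the parity of $k$, i.e. $\mathbf u_k[-m]=(-1)^k\mathbf u_k[m]$, and whose eigenvalue is preceded by exactly $\lfloor k/2\rfloor$ larger eigenvalues of $S$ on the vectors of that parity. The DFRT matrix of order $\alpha\in\mathbb R$ is $$\mathbf F^\alpha[m,n]=\sum_{k=0,\ k\ne M-1+(M\bmod 2)}^{M}\mathbf u_k[m]\,e^{-j\frac{\pi}{2}k\alpha}\,\mathbf u_k[n].$$ **GFT, GFRT and JFRT.** A GFT matrix of a graph with adjacency matrix $\mathbf A\in\mathbb C^{N\times N}$ is $\mathbf F_G=\mathbf V^{-1}$, where $\mathbf A=\mathbf V\mathbf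 J_{\mathbf A}\mathbf V^{-1}$ is a Jordan decomposition (adjacency approach), or, if $\mathbf A$ is symmetric with non-negative entries, $\mathbf F_G=\mathbf U^H$, where $\mathbf L=\mathbf D-\mathbf A=\mathbf U\mathbf\Lambda\mathbf U^H$ is a unitary diagonalization of the Laplacian (Laplacian approach). Given a Jordan decomposition $\mathbf F_G=\mathbf P\mathbf J\mathbf P^{-1}$ and a choice of a logarithm $\ell$ of the eigenvalue $\lambda$ of each Jordan block, put $\lambda^s:=e^{s\ell}$ and $\mathbf F_G^\beta=\mathbf P\mathbf J^\beta\mathbf P^{-1}$ for $\beta\in\mathbb R$, where the $k$-th superdiagonal of the $\beta$-th power of a Jordan block with eigenvalue $\lambda$ is $\prod_{n=1}^k\frac{\beta+1-n}{n}\,\lambda^{\beta-k}$. For $\mathbf X\in\mathbb C^{N\times T}$ put $\mathrm{JFT}^{\alpha,\beta}(\mathbf X)=\mathbf F_G^\beta\,\mathbf X\,(\mathbf F^\alpha)^T$. **Proposition.** Suppose that the underlying graph on $v_0,\dots,v_{N-1}$ is the directed circular graph (edges $v_m\to v_{m+1}$ for all $m$ modulo $N$, or all of these reversed) or the undirected ring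 graph, with unit weights. Then: 1. The vectors $\mathbf u_k$ above exist and are unique up to sign, for every length $M\ge1$. 2. The GFT can be taken to be the DFT: $\mathbf F_G=\mathbf F$ is a GFT matrix of the graph, in the adjacency approach for the directed circular graph and in the Laplacian approach for the undirected ring graph. 3. With this $\mathbf F_G$, let $\mathbf P$ be the matrix with columns $\mathbf u_k$ ($0\le k\le N$, $k\neq N-1+(N\bmod 2)$, in increasing order). Then $\mathbf P$ is unitary, $\mathbf F_G=\mathbf P\mathbf J\mathbf P^{-1}$ with $\mathbf J=\mathrm{diag}(e^{-j\frac{\pi}{2}k})_k$, and, with this decomposition and the logarithms $-j\frac{\pi}{2}k$ of the diagonal entries, $\mathbf F_G^\beta=\mathbf F^\beta$ for all $\beta\in\mathbb R$. 4. Hence, for all $\alpha,\beta\in\mathbb R$ and all $\mathbf X\in\mathbb C^{N\times T}$, $\mathrm{JFT}^{\alpha,\beta}(\mathbf X)=\mathbf F^\beta\mathbf X(\mathbf F^\alpha)^T$, which is the two-dimensional DFRT of $\mathbf X$ of order $\alpha$ in time and $\beta$ over the vertices: its $(p,q)$ entry is $\sum_{m=0}^{N-1}\sum_{n=0}^{T-1}\mathbf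 F^\beta[p,m]\,\mathbf F^\alpha[q,n]\,\mathbf X_{m,n}$. -/

import Mathlib

noncomputable section

namespace JointFRT

/-! ### The normalized DFT matrix and the discrete fractional Fourier transform -/

/-- The normalized `N × N` DFT matrix, with entries `exp (-2πi m n / N) / √N`. -/
def dftMatrix (N : ℕ) : Matrix (Fin N) (Fin N) ℂ :=
  Matrix.of fun m n =>
    Complex.exp (-(2 * (Real.pi : ℂ) * Complex.I * ((m : ℕ) : ℂ) * ((n : ℕ) : ℂ) / (N : ℂ))) /
      ((Real.sqrt (N : ℝ) : ℝ) : ℂ)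

/-- The discrete harmonic-oscillator (Hermite-Gauss) operator
`(S f)(m) = f (m + 1) + f (m - 1) + (2 cos (2πm / N) - 4) f m`, indices modulo `N`.
It commutes with the DFT, and its eigenvectors are the discrete Hermite-Gaussians. -/
def hermiteMatrix (N : ℕ) [NeZero N] : Matrix (Fin N) (Fin N) ℝ :=
  Matrix.of fun m n =>
    (if n = m + 1 then 1 else 0) + (if n = m - 1 then 1 else 0) +
      (if n = m then 2 * Real.cos (2 * Real.pi * ((m : ℕ) : ℝ) / (N : ℝ)) - 4 else 0)

/-- `v` has the parity of `k`: even (modulo `N`) for even `k`, odd for odd `k`. -/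
def HasParity {N : ℕ} [NeZero N] (k : ℕ) (v : Fin N → ℝ) : Prop :=
  ∀ n : Fin N, v (-n) = (-1) ^ k * v n

/-- `μ` is an eigenvalue of `hermiteMatrix N` on the vectors with the parity of `k`. -/
def IsParityEigenvalue (N : ℕ) [NeZero N] (k : ℕ) (μ : ℝ) : Prop :=
  ∃ w : Fin N → ℝ, w ≠ 0 ∧ HasParity k w ∧ (hermiteMatrix N).mulVec w = μ • w

/-- `v` is a `k`-th discrete Hermite-Gaussian of length `N`: a real unit eigenvector of
`hermiteMatrix N`, with the parity of `k`, whose eigenvalue is preceded by exactly `⌊k / 2⌋` larger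
ones within that parity (so the even ones are, in decreasing order of eigenvalue, numbered
`0, 2, 4, …`, and the odd ones `1, 3, 5, …`). -/
def IsDiscreteHermiteGaussian (N : ℕ) [NeZero N] (k : ℕ) (v : Fin N → ℝ) : Prop :=
  (∑ n, v n ^ 2 = 1) ∧ HasParity k v ∧
    ∃ μ : ℝ, (hermiteMatrix N).mulVec v = μ • v ∧
      {ν : ℝ | μ < ν ∧ IsParityEigenvalue N k ν}.ncard = k / 2

open Classical in
/-- The `k`-th discrete Hermite-Gaussian `u_k` of length `N` (its sign is immaterial). -/
def hermiteGaussian (N : ℕ) [NeZero N] (k : ℕ) : Fin N → ℝ :=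
  if h : ∃ v, IsDiscreteHermiteGaussian N k v then h.choose else 0

/-- The orders used in the DFRT of length `N`: all `0 ≤ k ≤ N` except `k = N - 1 + (N mod 2)`,
that is, `0, …, N - 1` for odd `N` and `0, …, N - 2, N` for even `N`. -/
def orderSet (N : ℕ) : Finset ℕ := (Finset.range (N + 1)).erase (N - 1 + N % 2)

/-- The increasing enumeration of `orderSet N`. -/
def order (N : ℕ) (i : Fin N) : ℕ :=
  if Even N ∧ (i : ℕ) + 1 = N then N else (i : ℕ)

/-- The DFRT matrix `F^α` of length `N`. -/
def dfrt (N : ℕ) [NeZero N] (α : ℝ) : Matrix (Fin N) (Fin N) ℂ :=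
  Matrix.of fun m n =>
    ∑ k ∈ orderSet N,
      (hermiteGaussian N k m : ℂ) *
        Complex.exp (-(Complex.I * ((Real.pi : ℂ) / 2) * (k : ℂ) * (α : ℂ))) *
          (hermiteGaussian N k n : ℂ)

/-- The two-dimensional DFRT of an `N × T` array, of order `α` along the second index (time) and of
order `β` along the first index (vertices). -/
def dfrt2D {N T : ℕ} [NeZero N] [NeZero T] (α β : ℝ) (X : Matrix (Fin N) (Fin T) ℂ) :
    Matrix (Fin N) (Fin T) ℂ :=
  Matrix.of fun p q => ∑ m : Fin N, ∑ n : Fin T, dfrt N β p m * dfrt T α q n * X m n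

/-! ### Graph Fourier transforms -/

/-- `J` is a matrix in (upper) Jordan form. -/
def IsJordanMatrix {N : ℕ} (J : Matrix (Fin N) (Fin N) ℂ) : Prop :=
  (∀ i j : Fin N, (j : ℕ) ≠ i → (j : ℕ) ≠ i + 1 → J i j = 0) ∧
    ∀ i j : Fin N, (j : ℕ) = i + 1 → J i j = 0 ∨ (J i j = 1 ∧ J i i = J j j)

/-- `FG` is a GFT matrix for the adjacency matrix `A` in the algebraic approach: `A = V J V⁻¹` is a
Jordan decomposition and `FG = V⁻¹`. -/
def IsAlgebraicGFT {N : ℕ} (A FG : Matrix (Fin N) (Fin N) ℂ) : Prop :=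
  ∃ V J : Matrix (Fin N) (Fin N) ℂ,
    IsUnit V.det ∧ IsJordanMatrix J ∧ A = V * J * V⁻¹ ∧ FG = V⁻¹

/-- The combinatorial Laplacian `D - A`. -/
def laplacian {N : ℕ} (A : Matrix (Fin N) (Fin N) ℂ) : Matrix (Fin N) (Fin N) ℂ :=
  Matrix.diagonal (fun m => ∑ n, A m n) - A

/-- `FG` is a GFT matrix for the symmetric non-negative adjacency matrix `A` in the Laplacian
approach: `L = U Λ Uᴴ` is a unitary diagonalization of the Laplacian and `FG = Uᴴ`. -/
def IsLaplacianGFT {N : ℕ} (A FG : Matrix (Fin N) (Fin N) ℂ) : Prop :=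
  (∀ m n, ∃ r : ℝ, 0 ≤ r ∧ A m n = (r : ℂ)) ∧ A.IsSymm ∧
    ∃ U ∈ Matrix.unitaryGroup (Fin N) ℂ, ∃ Λ : Fin N → ℝ,
      laplacian A = U * Matrix.diagonal (fun i => (Λ i : ℂ)) * U.conjTranspose ∧
        FG = U.conjTranspose

/-- `A` is the adjacency matrix of a directed circular graph on `v_0, …, v_{N-1}`: its edges are
`v_m → v_{m+1}` for all `m` modulo `N`, or all of these reversed. -/
def IsDirectedCircular {N : ℕ} [NeZero N] (A : Matrix (Fin N) (Fin N) ℂ) : Prop :=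
  (∀ m n, A m n = if n = m + 1 then 1 else 0) ∨ (∀ m n, A m n = if m = n + 1 then 1 else 0)

/-- `A` is the adjacency matrix of the undirected ring graph on `v_0, …, v_{N-1}`. -/
def IsRing {N : ℕ} (A : Matrix (Fin N) (Fin N) ℂ) : Prop :=
  A = (SimpleGraph.cycleGraph N).adjMatrix ℂ

/-! ### The graph fractional Fourier transform and the joint transform -/

open Classical in
/-- The power `J^α` of a Jordan matrix, with the branch `λ_i^s = exp (s * ℓ i)` of the powers of the
eigenvalue `λ_i = J i i`: in a Jordan block with eigenvalue `λ`, the `k`-th superdiagonal is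
`∏_{n=1}^{k} (α + 1 - n) / n * λ^(α - k)`. -/
def jordanPow {N : ℕ} (J : Matrix (Fin N) (Fin N) ℂ) (ℓ : Fin N → ℂ) (α : ℝ) :
    Matrix (Fin N) (Fin N) ℂ :=
  Matrix.of fun i j =>
    if i ≤ j ∧ ∀ l l' : Fin N, i ≤ l → l' ≤ j → (l' : ℕ) = l + 1 → J l l' = 1 then
      (∏ n ∈ Finset.Icc 1 ((j : ℕ) - i), ((α : ℂ) + 1 - n) / n) *
        Complex.exp (((α : ℂ) - (((j : ℕ) - i : ℕ) : ℂ)) * ℓ i)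
    else 0

/-- The data on which the fractional powers of a GFT matrix `FG` depend: a Jordan decomposition
`FG = P J P⁻¹`, and for each Jordan block a logarithm of its eigenvalue. -/
structure GFRTData {N : ℕ} (FG : Matrix (Fin N) (Fin N) ℂ) where
  P : Matrix (Fin N) (Fin N) ℂ
  J : Matrix (Fin N) (Fin N) ℂ
  ℓ : Fin N → ℂ
  isUnit_det : IsUnit P.det
  isJordan : IsJordanMatrix J
  decomp : FG = P * J * P⁻¹
  exp_log : ∀ i, Complex.exp (ℓ i) = J i i
  log_block : ∀ i j : Fin N, (j : ℕ) = i + 1 → J i j = 1 → ℓ i = ℓ j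

/-- The GFRT matrix `FG^β = P J^β P⁻¹`. -/
def GFRTData.gfrt {N : ℕ} {FG : Matrix (Fin N) (Fin N) ℂ} (d : GFRTData FG) (β : ℝ) :
    Matrix (Fin N) (Fin N) ℂ :=
  d.P * jordanPow d.J d.ℓ β * d.P⁻¹

/-- The joint transform `JFT^{α,β}(X) = FG^β X (F^α)ᵀ`. -/
def GFRTData.jfrt {N T : ℕ} [NeZero T] {FG : Matrix (Fin N) (Fin N) ℂ} (d : GFRTData FG)
    (α β : ℝ) (X : Matrix (Fin N) (Fin T) ℂ) : Matrix (Fin N) (Fin T) ℂ :=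
  d.gfrt β * X * (dfrt T α).transpose

end JointFRT

end

/-! The crux is that the DFT multiplies the `k`-th discrete Hermite-Gaussian `u_k` by `(-i)^k`.
Since the `u_k` are orthonormal, the fractional powers of the DFT are then the spectral sums that
define the DFRT. The graph statements only need that the DFT diagonalizes circulant matrices.

The DFT commutes with `S`, and on vectors of one parity it acts as a real cosine kernel, or as `-i`
times a real sine kernel, whose square is the identity there. In a basis indexed by half of the
cycle, `S` becomes a Jacobi matrix `H` (`isJacobi_halfCompress`). Its spectrum is simple, which
gives existence and uniqueness of the `u_k`. The kernel becomes a matrix `G` whose row `m` is, up to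
positive row and column factors, a Chebyshev polynomial of degree `m` at decreasing nodes
(`halfCompress_parityKernel_chebyshev`). It remains to see that the eigenvalues `±1` of `G`
alternate along the decreasing spectrum of `H` (`neg_one_pow_mul_pos`).

This is a Perron-Frobenius argument in exterior powers. On alternating `k`-tensors the derivation
induced by `H` has a simple top eigenvalue, with eigenvector `u_0 ∧ ⋯ ∧ u_{k-1}` formed from the
eigenvectors of `H`. As `H` links only neighbouring indices, replacing the coordinates by their
absolute values with Vandermonde signs does not lower the quadratic form, so the new tensor lies in
the same eigenspace (`tensorCoeff_signedAbs_wedge`) and `G^{⊗k}` multiplies it by `g_0 ⋯ g_{k-1}`.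
The minors of the first `k` rows of `G` carry the same Vandermonde signs, which fixes the sign of
that product (`prod_mul_vandermonde_pos`). Comparing `k = i` with `k = i + 1` isolates the sign of
`g_i`. -/

section

open Finset

/-! ### Tensor powers and alternating tensors in coordinates. -/

namespace Oscillation

variable {d k : ℕ}

/-- The coordinates of the elementary tensor `u (t 0) ⊗ ⋯ ⊗ u (t (k - 1))`. -/
def tensorVec (u : Fin d → Fin d → ℝ) (t s : Fin k → Fin d) : ℝ := ∏ b, u (t b) (s b)

/-- The derivation `∑ b, 1 ⊗ ⋯ ⊗ H ⊗ ⋯ ⊗ 1` on `k`-tensors. -/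
def tensorDeriv (H : Matrix (Fin d) (Fin d) ℝ) (Φ : (Fin k → Fin d) → ℝ) (s : Fin k → Fin d) : ℝ :=
  ∑ b, ∑ n, H (s b) n * Φ (Function.update s b n)

/-- The `k`-th tensor power of `G`, acting on `k`-tensors. -/
def tensorAct (G : Matrix (Fin d) (Fin d) ℝ) (Φ : (Fin k → Fin d) → ℝ) (s : Fin k → Fin d) : ℝ :=
  ∑ s' : Fin k → Fin d, (∏ b, G (s b) (s' b)) * Φ s'

/-- The coordinates of a tensor in the basis of the elementary tensors. -/
def tensorCoeff (u : Fin d → Fin d → ℝ) (Φ : (Fin k → Fin d) → ℝ) (t : Fin k → Fin d) : ℝ :=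
  ∑ s, tensorVec u t s * Φ s

lemma sum_prod_eq (f : Fin k → Fin d → ℝ) :
    ∑ s : Fin k → Fin d, ∏ b, f b (s b) = ∏ b, ∑ n, f b n := by
  rw [Finset.prod_univ_sum, Fintype.piFinset_univ]

lemma prod_ite_eq_ite (s t : Fin k → Fin d) :
    (∏ b, if s b = t b then (1 : ℝ) else 0) = if s = t then 1 else 0 := by
  rw [Finset.prod_ite_zero]
  simp [funext_iff]

lemma tensorDeriv_tensorVec {H : Matrix (Fin d) (Fin d) ℝ} {u : Fin d → Fin d → ℝ} {μ : Fin d → ℝ}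
    (hH : ∀ i, H.mulVec (u i) = μ i • u i) (t s : Fin k → Fin d) :
    tensorDeriv H (tensorVec u t) s = (∑ b, μ (t b)) * tensorVec u t s := by
  unfold tensorDeriv
  rw [Finset.sum_mul]
  refine Finset.sum_congr rfl fun b _ => ?_
  have key : ∀ n, tensorVec u t (Function.update s b n) =
      u (t b) n * ∏ c ∈ univ.erase b, u (t c) (s c) := by
    intro n
    rw [tensorVec, ← Finset.mul_prod_erase _ _ (mem_univ b), Function.update_self]
    congr 1
    refine Finset.prod_congr rfl fun c hc => ?_
    rw [Function.update_of_ne (Finset.ne_of_mem_erase hc)]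
  have h2 := congrFun (hH (t b)) (s b)
  simp only [Matrix.mulVec, dotProduct, Pi.smul_apply, smul_eq_mul] at h2
  simp only [key, ← mul_assoc]
  rw [← Finset.sum_mul, h2, tensorVec, ← Finset.mul_prod_erase _ _ (mem_univ b)]
  ring

lemma tensorAct_tensorVec {G : Matrix (Fin d) (Fin d) ℝ} {u : Fin d → Fin d → ℝ} {g : Fin d → ℝ}
    (hG : ∀ i, G.mulVec (u i) = g i • u i) (t s : Fin k → Fin d) :
    tensorAct G (tensorVec u t) s = (∏ b, g (t b)) * tensorVec u t s := by
  unfold tensorAct tensorVec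
  simp only [← Finset.prod_mul_distrib]
  rw [sum_prod_eq (fun b n => G (s b) n * u (t b) n)]
  refine Finset.prod_congr rfl fun b _ => ?_
  have h2 := congrFun (hG (t b)) (s b)
  simpa only [Matrix.mulVec, dotProduct, Pi.smul_apply, smul_eq_mul] using h2

lemma tensorDeriv_sum {ι : Type*} (H : Matrix (Fin d) (Fin d) ℝ) (I : Finset ι) (c : ι → ℝ)
    (Φ : ι → (Fin k → Fin d) → ℝ) (s : Fin k → Fin d) :
    tensorDeriv H (fun s => ∑ i ∈ I, c i * Φ i s) s = ∑ i ∈ I, c i * tensorDeriv H (Φ i) s := by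
  unfold tensorDeriv
  simp only [Finset.mul_sum]
  conv_rhs => rw [Finset.sum_comm]
  refine Finset.sum_congr rfl fun b _ => ?_
  rw [Finset.sum_comm]
  exact Finset.sum_congr rfl fun i _ => Finset.sum_congr rfl fun n _ => by ring

lemma tensorAct_sum {ι : Type*} (G : Matrix (Fin d) (Fin d) ℝ) (I : Finset ι) (c : ι → ℝ)
    (Φ : ι → (Fin k → Fin d) → ℝ) (s : Fin k → Fin d) :
    tensorAct G (fun s => ∑ i ∈ I, c i * Φ i s) s = ∑ i ∈ I, c i * tensorAct G (Φ i) s := by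
  unfold tensorAct
  simp only [Finset.mul_sum]
  rw [Finset.sum_comm]
  exact Finset.sum_congr rfl fun i _ => Finset.sum_congr rfl fun n _ => by ring

section Orthonormal

variable {u : Fin d → Fin d → ℝ}

lemma sum_mul_comm_of_orthonormal (hu : ∀ i j, ∑ n, u i n * u j n = if i = j then 1 else 0)
    (n m : Fin d) : ∑ i, u i n * u i m = if n = m then 1 else 0 := by
  have h : (Matrix.of u) * (Matrix.of u).transpose = 1 := by
    ext i j
    simpa [Matrix.mul_apply, Matrix.one_apply] using hu i j
  have h' := congrFun (congrFun (show (Matrix.of u).transpose * Matrix.of u = 1 from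
    mul_eq_one_comm.mp h) n) m
  simpa [Matrix.mul_apply, Matrix.one_apply] using h'

lemma sum_tensorVec_mul (hu : ∀ i j, ∑ n, u i n * u j n = if i = j then 1 else 0)
    (t t' : Fin k → Fin d) :
    ∑ s, tensorVec u t s * tensorVec u t' s = if t = t' then 1 else 0 := by
  simp only [tensorVec, ← Finset.prod_mul_distrib]
  rw [sum_prod_eq (fun b n => u (t b) n * u (t' b) n)]
  simp only [hu, prod_ite_eq_ite]

lemma sum_tensorCoeff_mul (hu : ∀ i j, ∑ n, u i n * u j n = if i = j then 1 else 0)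
    (Φ : (Fin k → Fin d) → ℝ) (s : Fin k → Fin d) :
    ∑ t, tensorCoeff u Φ t * tensorVec u t s = Φ s := by
  simp only [tensorCoeff, Finset.sum_mul]
  rw [Finset.sum_comm]
  have : ∀ s', ∑ t : Fin k → Fin d, tensorVec u t s' * Φ s' * tensorVec u t s =
      (if s' = s then 1 else 0) * Φ s' := by
    intro s'
    rw [← prod_ite_eq_ite]
    simp only [← sum_mul_comm_of_orthonormal hu]
    rw [← sum_prod_eq (fun b i => u i (s' b) * u i (s b)), Finset.sum_mul]
    refine Finset.sum_congr rfl fun t _ => ?_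
    rw [Finset.prod_mul_distrib, tensorVec, tensorVec]
    ring
  simp [this]

/-- The quadratic form of the derivation, diagonalized; with `sum_sq_eq` it gives the Rayleigh
quotient in the eigenbasis. -/
lemma sum_mul_tensorDeriv (hu : ∀ i j, ∑ n, u i n * u j n = if i = j then 1 else 0)
    {H : Matrix (Fin d) (Fin d) ℝ} {μ : Fin d → ℝ} (hH : ∀ i, H.mulVec (u i) = μ i • u i)
    (Φ : (Fin k → Fin d) → ℝ) :
    ∑ s, Φ s * tensorDeriv H Φ s = ∑ t, (∑ b, μ (t b)) * tensorCoeff u Φ t ^ 2 := by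
  have h1 : ∀ s, tensorDeriv H Φ s =
      ∑ t, tensorCoeff u Φ t * ((∑ b, μ (t b)) * tensorVec u t s) := by
    intro s
    conv_lhs => rw [← funext (sum_tensorCoeff_mul hu Φ)]
    rw [tensorDeriv_sum]
    simp only [tensorDeriv_tensorVec hH]
  -- The eigenvalue is made opaque so that distributing products over sums leaves it intact.
  obtain ⟨M, hM⟩ : ∃ M : (Fin k → Fin d) → ℝ, ∀ t, ∑ b, μ (t b) = M t := ⟨_, fun _ => rfl⟩
  simp only [h1, hM, Finset.mul_sum]
  rw [Finset.sum_comm]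
  refine Finset.sum_congr rfl fun t _ => ?_
  rw [sq]
  nth_rewrite 3 [tensorCoeff]
  simp only [Finset.mul_sum]
  exact Finset.sum_congr rfl fun s _ => by ring

lemma sum_sq_eq (hu : ∀ i j, ∑ n, u i n * u j n = if i = j then 1 else 0)
    (Φ : (Fin k → Fin d) → ℝ) : ∑ s, Φ s ^ 2 = ∑ t, tensorCoeff u Φ t ^ 2 := by
  have h1 : ∀ s, Φ s ^ 2 = ∑ t, Φ s * (tensorCoeff u Φ t * tensorVec u t s) := by
    intro s
    rw [← Finset.mul_sum, sum_tensorCoeff_mul hu, sq]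
  simp only [h1]
  rw [Finset.sum_comm]
  refine Finset.sum_congr rfl fun t _ => ?_
  rw [sq]
  nth_rewrite 3 [tensorCoeff]
  simp only [Finset.mul_sum]
  exact Finset.sum_congr rfl fun s _ => by ring

lemma tensorAct_eq (hu : ∀ i j, ∑ n, u i n * u j n = if i = j then 1 else 0)
    {G : Matrix (Fin d) (Fin d) ℝ} {g : Fin d → ℝ} (hG : ∀ i, G.mulVec (u i) = g i • u i)
    (Φ : (Fin k → Fin d) → ℝ) (s : Fin k → Fin d) :
    tensorAct G Φ s = ∑ t, tensorCoeff u Φ t * ((∏ b, g (t b)) * tensorVec u t s) := by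
  conv_lhs => rw [← funext (sum_tensorCoeff_mul hu Φ)]
  rw [tensorAct_sum]
  simp only [tensorAct_tensorVec hG]

end Orthonormal

/-- A tensor is alternating if permuting its arguments multiplies it by the sign. -/
def IsAlternating (Φ : (Fin k → Fin d) → ℝ) : Prop :=
  ∀ (σ : Equiv.Perm (Fin k)) (s : Fin k → Fin d), Φ (s ∘ σ) = (Equiv.Perm.sign σ : ℝ) * Φ s

lemma IsAlternating.eq_zero {Φ : (Fin k → Fin d) → ℝ} (hΦ : IsAlternating Φ) {s : Fin k → Fin d}
    (hs : ¬ Function.Injective s) : Φ s = 0 := by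
  simp only [Function.Injective, not_forall] at hs
  obtain ⟨a, b, hab, hne⟩ := hs
  have h := hΦ (Equiv.swap a b) s
  have h2 : s ∘ Equiv.swap a b = s := by
    funext c
    simp only [Function.comp_apply, Equiv.swap_apply_def]
    split_ifs with h1 h2
    · rw [h1, hab]
    · rw [h2, hab]
    · rfl
  rw [h2, Equiv.Perm.sign_swap hne] at h
  simp at h
  linarith

/-- Permuting `t` can be undone by permuting the summation index. Hence only tuples of distinct
eigenvectors contribute to an alternating tensor. -/
lemma IsAlternating.tensorCoeff {Φ : (Fin k → Fin d) → ℝ} (hΦ : IsAlternating Φ)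
    (u : Fin d → Fin d → ℝ) : IsAlternating (tensorCoeff u Φ) := by
  intro σ t
  unfold Oscillation.tensorCoeff
  rw [Finset.mul_sum]
  refine Fintype.sum_equiv (Equiv.arrowCongr σ (Equiv.refl _)) _ _ fun s => ?_
  have h1 : (Equiv.arrowCongr σ (Equiv.refl (Fin d))) s = s ∘ σ.symm := rfl
  have h2 : Φ s = (Equiv.Perm.sign σ : ℝ) * Φ (s ∘ σ.symm) := by
    rw [← hΦ σ]
    congr 1
    funext c
    simp
  have h3 : tensorVec u (t ∘ σ) s = tensorVec u t (s ∘ σ.symm) := by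
    unfold tensorVec
    exact Fintype.prod_equiv σ _ _ fun b => by simp
  rw [h1, h2, h3]
  ring

lemma isAlternating_det (X : Fin k → Fin d → ℝ) :
    IsAlternating fun s : Fin k → Fin d => (Matrix.of fun a b => X a (s b)).det := by
  intro σ s
  have := Matrix.det_permute' σ (Matrix.of fun a b => X a (s b))
  simpa [Matrix.submatrix] using this

lemma isAlternating_vandermonde (x : Fin d → ℝ) :
    IsAlternating fun s : Fin k → Fin d => (Matrix.vandermonde (x ∘ s)).det := by
  intro σ s
  have := Matrix.det_permute σ (Matrix.vandermonde (x ∘ s))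
  simpa [Matrix.submatrix, Matrix.vandermonde] using this

/-- Averaging over simultaneous permutations turns products of entries of `G` into minors, as in
Cauchy-Binet. -/
lemma factorial_mul_tensorAct {Φ : (Fin k → Fin d) → ℝ} (hΦ : IsAlternating Φ)
    (G : Matrix (Fin d) (Fin d) ℝ) (s : Fin k → Fin d) :
    (Nat.factorial k : ℝ) * tensorAct G Φ s =
      ∑ s' : Fin k → Fin d, (Matrix.of fun a b => G (s a) (s' b)).det * Φ s' := by
  have h : ∀ σ : Equiv.Perm (Fin k), tensorAct G Φ s =
      ∑ s' : Fin k → Fin d, ((Equiv.Perm.sign σ : ℝ) * ∏ b, G (s (σ b)) (s' b)) * Φ s' := by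
    intro σ
    unfold tensorAct
    refine (Fintype.sum_equiv (Equiv.arrowCongr σ (Equiv.refl _)) _ _ fun s' => ?_).symm
    have h1 : (Equiv.arrowCongr σ (Equiv.refl (Fin d))) s' = s' ∘ σ.symm := rfl
    have h2 : Φ s' = (Equiv.Perm.sign σ : ℝ) * Φ (s' ∘ σ.symm) := by
      rw [← hΦ σ]
      congr 1
      funext c
      simp
    have h3 : ∏ b, G (s (σ b)) (s' b) = ∏ b, G (s b) ((s' ∘ σ.symm) b) :=
      Fintype.prod_equiv σ _ _ fun b => by simp
    have h4 : (Equiv.Perm.sign σ : ℝ) * (Equiv.Perm.sign σ : ℝ) = 1 := by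
      exact_mod_cast Int.units_coe_mul_self _
    rw [h1, h2, h3]
    linear_combination (∏ b, G (s b) ((s' ∘ σ.symm) b)) * Φ (s' ∘ σ.symm) * h4
  have h5 : ∑ _σ : Equiv.Perm (Fin k), tensorAct G Φ s = (Nat.factorial k : ℝ) * tensorAct G Φ s := by
    simp [Finset.sum_const, Fintype.card_perm]
  rw [← h5, Finset.sum_congr rfl fun σ _ => h σ, Finset.sum_comm]
  refine Finset.sum_congr rfl fun s' _ => ?_
  rw [Matrix.det_apply', Finset.sum_mul]
  simp

end Oscillation

noncomputable section

/-! ### Sign patterns in exterior powers and the alternation of eigenvalues. -/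

namespace Oscillation

variable {d k : ℕ}

/-- The sign of the Vandermonde determinant depends only on the relative order of the indices.
Moving one index to a neighbouring value cannot pass another index without meeting it, which
injectivity excludes. -/
lemma vandermonde_mul_pos {x : Fin d → ℝ} (hx : StrictAnti x) {s : Fin k → Fin d} {b : Fin k}
    {n : Fin d} (hn : (s b : ℕ) + 1 = n ∨ (n : ℕ) + 1 = s b) (hs : Function.Injective s)
    (hs' : Function.Injective (Function.update s b n)) :
    0 < (Matrix.vandermonde (x ∘ s)).det *
      (Matrix.vandermonde (x ∘ Function.update s b n)).det := by
  rw [Matrix.det_vandermonde, Matrix.det_vandermonde, ← Finset.prod_mul_distrib]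
  refine Finset.prod_pos fun i _ => ?_
  rw [← Finset.prod_mul_distrib]
  refine Finset.prod_pos fun j hj => ?_
  have hij : i ≠ j := (Finset.mem_Ioi.mp hj).ne
  have h1 : s i ≠ s j := hs.ne hij
  have h2 : Function.update s b n i ≠ Function.update s b n j := hs'.ne hij
  have h3 : s i < s j ↔ Function.update s b n i < Function.update s b n j := by
    by_cases hib : i = b
    · subst hib
      rw [Function.update_self, Function.update_of_ne hij.symm] at *
      omega
    · by_cases hjb : j = b
      · subst hjb
        rw [Function.update_self, Function.update_of_ne hij] at *
        omega
      · rw [Function.update_of_ne hib, Function.update_of_ne hjb]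
  simp only [Function.comp_apply]
  rcases lt_or_gt_of_ne h1 with h | h
  · exact mul_pos_of_neg_of_neg (sub_neg.mpr (hx h)) (sub_neg.mpr (hx (h3.mp h)))
  · have h4 : Function.update s b n j < Function.update s b n i := by
      rcases lt_or_gt_of_ne h2 with h5 | h5
      · exact absurd (h3.mpr h5) h.not_gt
      · exact h5
    exact mul_pos (sub_pos.mpr (hx h)) (sub_pos.mpr (hx h4))

lemma vandermonde_ne_zero {x : Fin d → ℝ} (hx : StrictAnti x) {s : Fin k → Fin d}
    (hs : Function.Injective s) : (Matrix.vandermonde (x ∘ s)).det ≠ 0 :=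
  Matrix.det_vandermonde_ne_zero_iff.mpr (hx.injective.comp hs)

/-- The absolute value of an alternating tensor, with the signs of an alternating tensor. -/
def signedAbs (x : Fin d → ℝ) (U : (Fin k → Fin d) → ℝ) (s : Fin k → Fin d) : ℝ :=
  |U s| * ((Matrix.vandermonde (x ∘ s)).det / |(Matrix.vandermonde (x ∘ s)).det|)

lemma isAlternating_signedAbs (x : Fin d → ℝ) {U : (Fin k → Fin d) → ℝ} (hU : IsAlternating U) :
    IsAlternating (signedAbs x U) := by
  intro σ s
  have h1 := isAlternating_vandermonde x σ s
  simp only at h1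
  unfold signedAbs
  rw [h1, hU σ s]
  rcases Int.units_eq_one_or (Equiv.Perm.sign σ) with h | h <;> simp [h, neg_div]

lemma signedAbs_sq {x : Fin d → ℝ} (hx : StrictAnti x) {U : (Fin k → Fin d) → ℝ}
    (hU : IsAlternating U) (s : Fin k → Fin d) : signedAbs x U s ^ 2 = U s ^ 2 := by
  by_cases hs : Function.Injective s
  · have := abs_ne_zero.mpr (vandermonde_ne_zero hx hs)
    rw [signedAbs, mul_pow, div_pow, sq_abs, sq_abs, div_self, mul_one]
    exact pow_ne_zero 2 (vandermonde_ne_zero hx hs)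
  · rw [hU.eq_zero hs, (isAlternating_signedAbs x hU).eq_zero hs]

lemma mul_le_signedAbs_mul {x : Fin d → ℝ} (hx : StrictAnti x) {U : (Fin k → Fin d) → ℝ}
    (hU : IsAlternating U) {s : Fin k → Fin d} {b : Fin k}
    {n : Fin d} (hn : (s b : ℕ) + 1 = n ∨ (n : ℕ) + 1 = s b) :
    U s * U (Function.update s b n) ≤ signedAbs x U s * signedAbs x U (Function.update s b n) := by
  by_cases hs : Function.Injective s
  · by_cases hs' : Function.Injective (Function.update s b n)
    · have h := vandermonde_mul_pos hx hn hs hs'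
      have h1 : signedAbs x U s * signedAbs x U (Function.update s b n) =
          |U s * U (Function.update s b n)| := by
        unfold signedAbs
        rw [mul_mul_mul_comm, div_mul_div_comm, ← abs_mul, ← abs_mul, abs_of_pos h,
          div_self h.ne', mul_one]
      rw [h1]
      exact le_abs_self _
    · rw [hU.eq_zero hs', (isAlternating_signedAbs x hU).eq_zero hs']
      simp
  · rw [hU.eq_zero hs, (isAlternating_signedAbs x hU).eq_zero hs]
    simp

/-- Diagonal terms see only squares and are unchanged. The surviving off-diagonal terms move one
index to a neighbour, where the new tensor has coherent signs. -/
lemma sum_mul_tensorDeriv_le {x : Fin d → ℝ} (hx : StrictAnti x) {U : (Fin k → Fin d) → ℝ}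
    (hU : IsAlternating U) {H : Matrix (Fin d) (Fin d) ℝ} (hH0 : ∀ i j, i ≠ j → 0 ≤ H i j)
    (hH1 : ∀ i j : Fin d, i ≠ j → (i : ℕ) + 1 ≠ j → (j : ℕ) + 1 ≠ i → H i j = 0) :
    ∑ s, U s * tensorDeriv H U s ≤
      ∑ s, signedAbs x U s * tensorDeriv H (signedAbs x U) s := by
  refine Finset.sum_le_sum fun s _ => ?_
  unfold tensorDeriv
  simp only [Finset.mul_sum]
  refine Finset.sum_le_sum fun b _ => Finset.sum_le_sum fun n _ => ?_
  by_cases hn : n = s b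
  · subst hn
    rw [Function.update_eq_self]
    have := signedAbs_sq hx hU s
    apply le_of_eq
    linear_combination -(H (s b) (s b)) * this
  · by_cases hadj : (s b : ℕ) + 1 = n ∨ (n : ℕ) + 1 = s b
    · have := mul_le_mul_of_nonneg_left (mul_le_signedAbs_mul hx hU hadj) (hH0 (s b) n (Ne.symm hn))
      linarith
    · push Not at hadj
      rw [hH1 _ _ (Ne.symm hn) hadj.1 hadj.2]
      simp

lemma sum_comp_lt {μ : Fin d → ℝ} (hμ : StrictAnti μ) (hk : k ≤ d) {t : Fin k → Fin d}
    (ht : Function.Injective t) (hlt : ¬ ∀ b, (t b : ℕ) < k) :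
    ∑ b, μ (t b) < ∑ a : Fin k, μ (Fin.castLE hk a) := by
  push Not at hlt
  obtain ⟨b₀, hb₀⟩ := hlt
  have hk0 : 0 < k := b₀.pos
  -- The `k`-th largest value is a threshold: after subtracting it, the first `k` terms are
  -- nonnegative and all others negative.
  set c := μ ⟨k - 1, by omega⟩ with hc
  have hlow : ∀ i : Fin d, (i : ℕ) < k → 0 ≤ μ i - c := fun i hi =>
    sub_nonneg.mpr (hμ.antitone (Fin.mk_le_mk.mpr (by omega) : i ≤ ⟨k - 1, by omega⟩))
  have hhigh : ∀ i : Fin d, ¬ (i : ℕ) < k → μ i - c < 0 := fun i hi =>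
    sub_neg.mpr (hμ (Fin.mk_lt_mk.mpr (by omega) : (⟨k - 1, by omega⟩ : Fin d) < i))
  have h1 : ∑ b, (μ (t b) - c) = ∑ i ∈ univ.map ⟨t, ht⟩, (μ i - c) := by
    rw [Finset.sum_map]; rfl
  have h2 : ∑ a : Fin k, (μ (Fin.castLE hk a) - c) = ∑ i ∈ univ.filter fun i : Fin d => (i : ℕ) < k, (μ i - c) := by
    refine Finset.sum_bij (fun a _ => Fin.castLE hk a) (by simp) ?_ ?_ (by simp)
    · intro a _ b _ h
      exact Fin.castLE_injective hk h
    · intro i hi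
      exact ⟨⟨i, (Finset.mem_filter.mp hi).2⟩, mem_univ _, rfl⟩
  have h3 : ∑ b, (μ (t b) - c) < ∑ a : Fin k, (μ (Fin.castLE hk a) - c) := by
    rw [h1, h2, ← Finset.sum_filter_add_sum_filter_not _ (fun i : Fin d => (i : ℕ) < k)]
    have h4 : ∑ i ∈ (univ.map ⟨t, ht⟩).filter fun i : Fin d => ¬ (i : ℕ) < k, (μ i - c) < 0 := by
      refine Finset.sum_neg (fun i hi => hhigh i (Finset.mem_filter.mp hi).2) ⟨t b₀, ?_⟩
      simp [hb₀]
    have h5 : ∑ i ∈ (univ.map ⟨t, ht⟩).filter fun i : Fin d => (i : ℕ) < k, (μ i - c) ≤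
        ∑ i ∈ univ.filter fun i : Fin d => (i : ℕ) < k, (μ i - c) :=
      Finset.sum_le_sum_of_subset_of_nonneg
        (Finset.filter_subset_filter _ (Finset.subset_univ _))
        fun i hi _ => hlow i (Finset.mem_filter.mp hi).2
    linarith
  simpa [Finset.sum_sub_distrib] using h3

lemma prod_comp_eq (g : Fin d → ℝ) (hk : k ≤ d) {t : Fin k → Fin d}
    (ht : Function.Injective t) (hlt : ∀ b, (t b : ℕ) < k) :
    ∏ b, g (t b) = ∏ a : Fin k, g (Fin.castLE hk a) := by
  have hinj : Function.Injective fun b => (⟨t b, hlt b⟩ : Fin k) := by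
    intro a b h
    exact ht (Fin.ext (by simpa using h))
  exact Fintype.prod_equiv (Equiv.ofBijective _ (Finite.injective_iff_bijective.mp hinj)) _ _
    fun b => rfl

variable {u : Fin d → Fin d → ℝ} {H : Matrix (Fin d) (Fin d) ℝ} {μ x : Fin d → ℝ}

/-- The exterior product of the first `k` vectors. -/
def wedge (u : Fin d → Fin d → ℝ) (hk : k ≤ d) (s : Fin k → Fin d) : ℝ :=
  (Matrix.of fun a b => u (Fin.castLE hk a) (s b)).det

lemma wedge_eq_sum (hk : k ≤ d) (s : Fin k → Fin d) :
    wedge u hk s = ∑ σ : Equiv.Perm (Fin k),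
      (Equiv.Perm.sign σ : ℝ) * tensorVec u (Fin.castLE hk ∘ σ) s := by
  rw [wedge, Matrix.det_apply']
  rfl

lemma tensorDeriv_wedge (hH : ∀ i, H.mulVec (u i) = μ i • u i) (hk : k ≤ d) (s : Fin k → Fin d) :
    tensorDeriv H (wedge u hk) s = (∑ a : Fin k, μ (Fin.castLE hk a)) * wedge u hk s := by
  conv_lhs => rw [funext (wedge_eq_sum hk), tensorDeriv_sum]
  rw [wedge_eq_sum, Finset.mul_sum]
  refine Finset.sum_congr rfl fun σ _ => ?_
  rw [tensorDeriv_tensorVec hH,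
    show ∑ b, μ ((Fin.castLE hk ∘ σ) b) = ∑ a : Fin k, μ (Fin.castLE hk a) from
      Fintype.sum_equiv σ _ _ fun b => rfl]
  ring

/-- Paired with `u_0 ⊗ ⋯ ⊗ u_{k-1}`, only the identity permutation survives, so the pairing is `1`.
-/
lemma exists_wedge_ne_zero (hu : ∀ i j, ∑ n, u i n * u j n = if i = j then 1 else 0) (hk : k ≤ d) :
    ∃ s, wedge u hk s ≠ 0 := by
  by_contra! h
  have h1 : ∑ s, tensorVec u (Fin.castLE hk) s * wedge u hk s = 1 := by
    simp only [wedge_eq_sum, Finset.mul_sum]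
    rw [Finset.sum_comm, Finset.sum_eq_single 1]
    · simp only [mul_left_comm (tensorVec _ _ _), ← Finset.mul_sum, sum_tensorVec_mul hu]
      simp
    · intro σ _ hσ
      simp only [mul_left_comm (tensorVec _ _ _), ← Finset.mul_sum, sum_tensorVec_mul hu]
      rw [if_neg, mul_zero]
      intro h2
      apply hσ
      ext b
      have := congrFun h2 b
      simpa [Fin.ext_iff] using this.symm
    · simp
  simp [h] at h1

/-- An alternating tensor with a given sign pattern whose coefficients in the eigenbasis live on the
top eigenspace of the derivation. -/
lemma tensorCoeff_signedAbs_wedge (hx : StrictAnti x)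
    (hu : ∀ i j, ∑ n, u i n * u j n = if i = j then 1 else 0)
    (hH : ∀ i, H.mulVec (u i) = μ i • u i) (hμ : StrictAnti μ)
    (hH0 : ∀ i j, i ≠ j → 0 ≤ H i j)
    (hH1 : ∀ i j : Fin d, i ≠ j → (i : ℕ) + 1 ≠ j → (j : ℕ) + 1 ≠ i → H i j = 0) (hk : k ≤ d)
    {t : Fin k → Fin d} (ht : tensorCoeff u (signedAbs x (wedge u hk)) t ≠ 0) :
    Function.Injective t ∧ ∀ b, (t b : ℕ) < k := by
  have hU : IsAlternating (wedge u hk) := isAlternating_det _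
  set W := signedAbs x (wedge u hk) with hWdef
  have hW : IsAlternating W := isAlternating_signedAbs x hU
  set M := ∑ a : Fin k, μ (Fin.castLE hk a) with hM
  have hle : ∀ t : Fin k → Fin d, (∑ b, μ (t b)) * tensorCoeff u W t ^ 2 ≤
      M * tensorCoeff u W t ^ 2 := by
    intro t
    by_cases hti : Function.Injective t
    · by_cases htk : ∀ b, (t b : ℕ) < k
      · refine mul_le_mul_of_nonneg_right (le_of_eq ?_) (sq_nonneg _)
        have hinj : Function.Injective fun b => (⟨t b, htk b⟩ : Fin k) := by
          intro a b h
          exact hti (Fin.ext (by simpa using h))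
        exact Fintype.sum_equiv
          (Equiv.ofBijective _ (Finite.injective_iff_bijective.mp hinj)) _ _ fun b => rfl
      · exact mul_le_mul_of_nonneg_right (sum_comp_lt hμ hk hti htk).le (sq_nonneg _)
    · rw [(hW.tensorCoeff u).eq_zero hti]
      simp
  -- The absolute values keep the norm, so the left side is the quadratic form of the derivation at
  -- the wedge, and the passage to `W` does not lower that form.
  have hge : ∑ t : Fin k → Fin d, M * tensorCoeff u W t ^ 2 ≤
      ∑ t, (∑ b, μ (t b)) * tensorCoeff u W t ^ 2 := by
    rw [← sum_mul_tensorDeriv hu hH, ← Finset.mul_sum, ← sum_sq_eq hu]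
    refine le_trans (le_of_eq ?_) (sum_mul_tensorDeriv_le hx hU hH0 hH1)
    rw [Finset.mul_sum]
    refine Finset.sum_congr rfl fun s _ => ?_
    rw [hWdef, signedAbs_sq hx hU, tensorDeriv_wedge hH]
    ring
  -- Termwise inequalities whose sums agree are equalities, so no coefficient lies strictly below
  -- the top eigenvalue.
  have heq := (Finset.sum_eq_sum_iff_of_le fun t _ => hle t).mp
    (le_antisymm (Finset.sum_le_sum fun t _ => hle t) hge) t (mem_univ _)
  have hti : Function.Injective t := by
    by_contra h
    exact ht ((hW.tensorCoeff u).eq_zero h)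
  refine ⟨hti, ?_⟩
  by_contra h
  exact (sum_comp_lt hμ hk hti h).ne (mul_right_cancel₀ (pow_ne_zero 2 ht) heq)

/-- The product of the first `k` eigenvalues of `G` has the sign of a Vandermonde determinant. -/
theorem prod_mul_vandermonde_pos {G : Matrix (Fin d) (Fin d) ℝ} {g : Fin d → ℝ} (hx : StrictAnti x)
    (hu : ∀ i j, ∑ n, u i n * u j n = if i = j then 1 else 0)
    (hH : ∀ i, H.mulVec (u i) = μ i • u i) (hμ : StrictAnti μ)
    (hH0 : ∀ i j, i ≠ j → 0 ≤ H i j)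
    (hH1 : ∀ i j : Fin d, i ≠ j → (i : ℕ) + 1 ≠ j → (j : ℕ) + 1 ≠ i → H i j = 0)
    (hG : ∀ i, G.mulVec (u i) = g i • u i) (hk : k ≤ d)
    (hGdet : ∀ s : Fin k → Fin d, ∃ c : ℝ, 0 < c ∧
      (Matrix.of fun a b => G (Fin.castLE hk a) (s b)).det =
        c * (Matrix.vandermonde (x ∘ s)).det) :
    0 < (∏ a : Fin k, g (Fin.castLE hk a)) *
      (Matrix.vandermonde (x ∘ Fin.castLE hk)).det := by
  have hU : IsAlternating (wedge u hk) := isAlternating_det _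
  set W := signedAbs x (wedge u hk) with hWdef
  have hW : IsAlternating W := isAlternating_signedAbs x hU
  set Λ := ∏ a : Fin k, g (Fin.castLE hk a) with hΛ
  set v : (Fin k → Fin d) → ℝ := fun s => (Matrix.vandermonde (x ∘ s)).det with hv
  -- Each contributing `t` permutes the first `k` indices, so all contributing basis tensors share
  -- the eigenvalue `Λ`.
  have h1 : tensorAct G W (Fin.castLE hk) = Λ * W (Fin.castLE hk) := by
    rw [tensorAct_eq hu hG, ← sum_tensorCoeff_mul hu W, Finset.mul_sum]
    refine Finset.sum_congr rfl fun t _ => ?_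
    by_cases ht : tensorCoeff u W t = 0
    · simp [ht]
    · obtain ⟨hti, htk⟩ := tensorCoeff_signedAbs_wedge hx hu hH hμ hH0 hH1 hk ht
      rw [prod_comp_eq g hk hti htk]
      ring
  -- In the expansion into minors, each minor and the matching coordinate of `W` have the same
  -- Vandermonde sign, so every term is nonnegative.
  have h2 : 0 < (Nat.factorial k : ℝ) * tensorAct G W (Fin.castLE hk) := by
    rw [factorial_mul_tensorAct hW]
    have hterm : ∀ s : Fin k → Fin d, ∃ c : ℝ, 0 < c ∧
        (Matrix.of fun a b => G (Fin.castLE hk a) (s b)).det * W s =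
          c * (|wedge u hk s| * |v s|) := by
      intro s
      obtain ⟨c, hc, h⟩ := hGdet s
      refine ⟨c, hc, ?_⟩
      rw [h, hWdef, signedAbs]
      by_cases h0 : (Matrix.vandermonde (x ∘ s)).det = 0
      · simp [hv, h0]
      · have : |(Matrix.vandermonde (x ∘ s)).det| ≠ 0 := abs_ne_zero.mpr h0
        simp only [hv]
        field_simp
        rw [sq_abs, mul_comm]
    obtain ⟨s₀, hs₀⟩ := exists_wedge_ne_zero hu hk
    refine Finset.sum_pos' (fun s _ => ?_) ⟨s₀, mem_univ _, ?_⟩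
    · obtain ⟨c, hc, h⟩ := hterm s
      rw [h]
      positivity
    · obtain ⟨c, hc, h⟩ := hterm s₀
      rw [h]
      have hinj : Function.Injective s₀ := by
        by_contra h
        exact hs₀ (hU.eq_zero h)
      have := vandermonde_ne_zero hx hinj
      have h3 : 0 < |v s₀| := abs_pos.mpr this
      positivity
  have h3 : 0 < Λ * W (Fin.castLE hk) := by
    rw [← h1]
    exact pos_of_mul_pos_right h2 (by positivity)
  have h4 : Λ * W (Fin.castLE hk) =
      (Λ * v (Fin.castLE hk)) * (|wedge u hk (Fin.castLE hk)| / |v (Fin.castLE hk)|) := by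
    rw [hWdef, signedAbs]
    ring
  rw [h4] at h3
  exact pos_of_mul_pos_left h3 (by positivity)

/-- With positive row and column factors and leading coefficients pulled out, the first `k` rows
hold monic polynomials of degrees `0, …, k - 1`. Row operations reduce these to powers. -/
lemma det_eval_eq {q : Fin d → Polynomial ℝ} (hq : ∀ m, (q m).natDegree = m)
    {G : Matrix (Fin d) (Fin d) ℝ} {α β : Fin d → ℝ}
    (hα : ∀ m, 0 < α m) (hβ : ∀ m, 0 < β m) (hlead : ∀ m, 0 < (q m).leadingCoeff)
    (hG : ∀ m n, G m n = α m * β n * (q m).eval (x n)) (hk : k ≤ d) (s : Fin k → Fin d) :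
    ∃ c : ℝ, 0 < c ∧ (Matrix.of fun a b => G (Fin.castLE hk a) (s b)).det =
      c * (Matrix.vandermonde (x ∘ s)).det := by
  let p : Fin k → Polynomial ℝ := fun a =>
    Polynomial.C (q (Fin.castLE hk a)).leadingCoeff⁻¹ * q (Fin.castLE hk a)
  have hp : ∀ a, (p a).natDegree = a := by
    intro a
    rw [Polynomial.natDegree_C_mul (inv_ne_zero (hlead _).ne'), hq]
    rfl
  have hpm : ∀ a, (p a).Monic := by
    intro a
    rw [Polynomial.Monic, Polynomial.leadingCoeff_mul, Polynomial.leadingCoeff_C,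
      inv_mul_cancel₀ (hlead _).ne']
  have h := Matrix.det_eval_matrixOfPolynomials_eq_det_vandermonde (x ∘ s) p hp hpm
  have h2 : (Matrix.of fun a b => G (Fin.castLE hk a) (s b)) =
      Matrix.of fun a b => β (s b) * (Matrix.of fun a b =>
        (α (Fin.castLE hk a) * (q (Fin.castLE hk a)).leadingCoeff) *
          (Matrix.of fun i j => (p j).eval ((x ∘ s) i)).transpose a b) a b := by
    ext a b
    have := (hlead (Fin.castLE hk a)).ne'
    simp only [Matrix.of_apply, Matrix.transpose_apply, hG, p, Polynomial.eval_mul,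
      Polynomial.eval_C, Function.comp_apply]
    field_simp
  refine ⟨(∏ b, β (s b)) * ∏ a, (α (Fin.castLE hk a) * (q (Fin.castLE hk a)).leadingCoeff),
    mul_pos (Finset.prod_pos fun b _ => hβ _)
      (Finset.prod_pos fun a _ => mul_pos (hα _) (hlead _)), ?_⟩
  rw [h2, Matrix.det_mul_row, Matrix.det_mul_column, Matrix.det_transpose, h, mul_assoc]

/-- **Alternation of signs.** If the symmetric tridiagonal matrix `H` has non-negative off-diagonal
entries and simple spectrum, then the eigenvalues of a commuting matrix `G` of Chebyshev type
alternate in sign along the decreasing eigenvalues of `H`. -/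
theorem neg_one_pow_mul_pos {G : Matrix (Fin d) (Fin d) ℝ} {g : Fin d → ℝ} (hx : StrictAnti x)
    (hu : ∀ i j, ∑ n, u i n * u j n = if i = j then 1 else 0)
    (hH : ∀ i, H.mulVec (u i) = μ i • u i) (hμ : StrictAnti μ)
    (hH0 : ∀ i j, i ≠ j → 0 ≤ H i j)
    (hH1 : ∀ i j : Fin d, i ≠ j → (i : ℕ) + 1 ≠ j → (j : ℕ) + 1 ≠ i → H i j = 0)
    (hGu : ∀ i, G.mulVec (u i) = g i • u i)
    {q : Fin d → Polynomial ℝ} (hq : ∀ m, (q m).natDegree = m) {α β : Fin d → ℝ}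
    (hα : ∀ m, 0 < α m) (hβ : ∀ m, 0 < β m) (hlead : ∀ m, 0 < (q m).leadingCoeff)
    (hG : ∀ m n, G m n = α m * β n * (q m).eval (x n)) (i : Fin d) :
    0 < (-1) ^ (i : ℕ) * g i := by
  -- From `k = i` to `k = i + 1` the eigenvalue product gains `g i`, and the Vandermonde determinant
  -- gains `i` factors, all negative because `x` decreases.
  have h0 := prod_mul_vandermonde_pos (k := i) hx hu hH hμ hH0 hH1 hGu i.2.le
    (det_eval_eq hq hα hβ hlead hG _)
  have h1 := prod_mul_vandermonde_pos (k := i + 1) hx hu hH hμ hH0 hH1 hGu i.2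
    (det_eval_eq hq hα hβ hlead hG _)
  have hprod : ∏ a : Fin (i + 1), g (Fin.castLE i.2 a) =
      (∏ a : Fin i, g (Fin.castLE i.2.le a)) * g i := by
    rw [Fin.prod_univ_castSucc]
    rfl
  have hvdm : ∃ c : ℝ, 0 < c ∧ (Matrix.vandermonde (x ∘ Fin.castLE (show (i : ℕ) + 1 ≤ d from i.2))).det =
      (-1) ^ (i : ℕ) * c * (Matrix.vandermonde (x ∘ Fin.castLE i.2.le)).det := by
    refine ⟨∏ a : Fin i, (x (Fin.castLE i.2.le a) - x i), Finset.prod_pos fun a _ =>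
      sub_pos.mpr (hx (Fin.lt_def.mpr a.2)), ?_⟩
    rw [Matrix.det_vandermonde, Matrix.det_vandermonde, Fin.prod_univ_castSucc]
    have hlast : Finset.Ioi (Fin.last (i : ℕ)) = ∅ := by
      ext j
      simp [Fin.le_last]
    rw [hlast, Finset.prod_empty, mul_one]
    have hIoi : ∀ a : Fin i, ∏ j ∈ Finset.Ioi a.castSucc,
        ((x ∘ Fin.castLE (show (i : ℕ) + 1 ≤ d from i.2)) j - (x ∘ Fin.castLE (show (i : ℕ) + 1 ≤ d from i.2)) a.castSucc) =
        (-1) * (x (Fin.castLE i.2.le a) - x i) * ∏ j ∈ Finset.Ioi a,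
          ((x ∘ Fin.castLE i.2.le) j - (x ∘ Fin.castLE i.2.le) a) := by
      intro a
      have : Finset.Ioi a.castSucc = insert (Fin.last (i : ℕ)) ((Finset.Ioi a).map Fin.castSuccEmb) := by
        ext j
        induction j using Fin.lastCases with
        | last => simp [Fin.castSucc_lt_last]
        | cast j => simp [Fin.le_last]
      rw [this, Finset.prod_insert (by simp), Finset.prod_map]
      congr 1
      simp only [Function.comp_apply]
      rw [neg_one_mul, neg_sub]
      rfl
    simp only [hIoi, Finset.prod_mul_distrib]
    simp
  obtain ⟨c, hc, hvdm⟩ := hvdm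
  rw [hprod, hvdm] at h1
  have h2 : 0 < ((-1) ^ (i : ℕ) * g i) * (c * ((∏ a : Fin i, g (Fin.castLE i.2.le a)) *
      (Matrix.vandermonde (x ∘ Fin.castLE i.2.le)).det)) := by
    convert h1 using 1
    ring
  exact pos_of_mul_pos_left h2 (mul_pos hc h0).le

end Oscillation

end

/-! ### Jacobi matrices: simple spectrum and alternating eigenbasis. -/

namespace Oscillation

variable {d : ℕ} {H : Matrix (Fin d) (Fin d) ℝ}

/-- A symmetric tridiagonal matrix with positive off-diagonal entries. -/
structure IsJacobi (H : Matrix (Fin d) (Fin d) ℝ) : Prop where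
  isSymm : H.IsSymm
  pos : ∀ i j : Fin d, (i : ℕ) + 1 = j → 0 < H i j
  eq_zero : ∀ i j : Fin d, i ≠ j → (i : ℕ) + 1 ≠ j → (j : ℕ) + 1 ≠ i → H i j = 0

lemma IsJacobi.nonneg (hH : IsJacobi H) (i j : Fin d) (hij : i ≠ j) : 0 ≤ H i j := by
  by_cases h1 : (i : ℕ) + 1 = j
  · exact (hH.pos i j h1).le
  · by_cases h2 : (j : ℕ) + 1 = i
    · rw [← hH.isSymm.apply i j]
      exact (hH.pos j i h2).le
    · exact (hH.eq_zero i j hij h1 h2).ge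

/-- The eigenvalue equation is a three-term recurrence: row `n - 1` determines `v n` from earlier
entries, since its coefficient is positive. -/
lemma IsJacobi.eq_zero_of_apply_zero (hH : IsJacobi H) {μ : ℝ} {v : Fin d → ℝ}
    (hv : H.mulVec v = μ • v) (h0 : ∀ i : Fin d, (i : ℕ) = 0 → v i = 0) : v = 0 := by
  have key : ∀ n : ℕ, ∀ i : Fin d, (i : ℕ) = n → v i = 0 := by
    intro n
    induction n using Nat.strong_induction_on with
    | _ n ih =>
      intro i hi
      rcases Nat.eq_zero_or_pos n with hn | hn
      · exact h0 i (hi.trans hn)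
      · let p : Fin d := ⟨n - 1, by omega⟩
        have h1 := congrFun hv p
        rw [Matrix.mulVec, dotProduct, Finset.sum_eq_single i] at h1
        · rw [Pi.smul_apply, ih (n - 1) (by omega) p rfl, smul_zero] at h1
          exact (mul_eq_zero.mp h1).resolve_left
            (hH.pos p i (by simp only [p]; omega)).ne'
        · intro j _ hj
          by_cases hjn : (j : ℕ) < n
          · rw [ih j hjn j rfl, mul_zero]
          · have hji : (j : ℕ) ≠ i := fun h => hj (Fin.ext h)
            rw [hH.eq_zero p j, zero_mul]
            · exact Fin.ne_of_val_ne (by simp only [p]; omega)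
            · simp only [p]; omega
            · simp only [p]; omega
        · simp
  funext i
  exact key i i rfl

/-- The first coordinate is injective on each eigenspace, so eigenspaces are at most
one-dimensional. -/
lemma IsJacobi.exists_smul_eq (hH : IsJacobi H) {μ : ℝ} {v w : Fin d → ℝ}
    (hv : H.mulVec v = μ • v) (hv0 : v ≠ 0) (hw : H.mulVec w = μ • w) : ∃ c : ℝ, w = c • v := by
  have hd : 0 < d := by
    rcases Nat.eq_zero_or_pos d with rfl | h
    · exact absurd (Subsingleton.elim v 0) hv0
    · exact h
  let o : Fin d := ⟨0, hd⟩
  have ho : ∀ i : Fin d, (i : ℕ) = 0 → i = o := fun i hi => Fin.ext hi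
  have hvo : v o ≠ 0 := fun h =>
    hv0 (hH.eq_zero_of_apply_zero hv fun i hi => by rw [ho i hi, h])
  refine ⟨w o / v o, ?_⟩
  have h : w - (w o / v o) • v = 0 := by
    refine hH.eq_zero_of_apply_zero (μ := μ) ?_ fun i hi => ?_
    · rw [Matrix.mulVec_sub, Matrix.mulVec_smul, hv, hw, smul_sub, smul_comm]
    · rw [ho i hi]
      simp [hvo]
  exact sub_eq_zero.mp h

lemma IsJacobi.exists_eigenbasis (hH : IsJacobi H) : ∃ (u : Fin d → Fin d → ℝ) (μ : Fin d → ℝ),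
    (∀ i j, ∑ n, u i n * u j n = if i = j then 1 else 0) ∧ StrictAnti μ ∧
      ∀ i, H.mulVec (u i) = μ i • u i := by
  have hA : H.IsHermitian := by
    rw [Matrix.IsHermitian, Matrix.conjTranspose_eq_transpose_of_trivial]
    exact hH.isSymm
  set u₀ : Fin d → Fin d → ℝ := fun i => (hA.eigenvectorBasis i).ofLp with hu₀
  have horth : ∀ i j, ∑ n, u₀ i n * u₀ j n = if i = j then 1 else 0 := by
    intro i j
    have := orthonormal_iff_ite.mp hA.eigenvectorBasis.orthonormal j i
    rw [PiLp.inner_apply] at this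
    simp only [RCLike.inner_apply, conj_trivial] at this
    rw [hu₀]
    simp only [this, eq_comm]
  have heig : ∀ i, H.mulVec (u₀ i) = hA.eigenvalues i • u₀ i := fun i =>
    hA.mulVec_eigenvectorBasis i
  have hinj : Function.Injective hA.eigenvalues := by
    intro i j hij
    by_contra hne
    have h0 : u₀ i ≠ 0 := by
      intro h
      have := horth i i
      simp [h] at this
    obtain ⟨c, hc⟩ := hH.exists_smul_eq (heig i) h0 (w := u₀ j) (by rw [heig j, hij])
    have h1 := horth i j
    have h2 := horth i i
    have h3 := horth j j
    simp only [hc, Pi.smul_apply, smul_eq_mul, mul_left_comm _ c, ← Finset.mul_sum, h2,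
      if_neg hne] at h1
    simp only [if_true, mul_one] at h1
    simp [hc, h1] at h3
  -- Sorting the negatives puts the eigenvalues in decreasing order; strictness comes from
  -- simplicity.
  let σ := Tuple.sort fun i => - hA.eigenvalues i
  refine ⟨fun i => u₀ (σ i), fun i => hA.eigenvalues (σ i), fun i j => ?_, ?_, fun i => heig _⟩
  · rw [horth]
    simp
  · have hm : Monotone ((fun i => - hA.eigenvalues i) ∘ σ) := Tuple.monotone_sort _
    have hm' : StrictMono ((fun i => - hA.eigenvalues i) ∘ σ) :=
      hm.strictMono_of_injective
        ((neg_injective.comp hinj).comp σ.injective)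
    intro i j hij
    have := hm' hij
    simpa using this

/-- Some basis vector is not orthogonal to `w`, and eigenvectors of a symmetric matrix that are not
orthogonal share their eigenvalue. -/
lemma IsJacobi.exists_eq_smul_of_eigenvector (hH : IsJacobi H) {u : Fin d → Fin d → ℝ}
    {μ : Fin d → ℝ} (hu : ∀ i j, ∑ n, u i n * u j n = if i = j then 1 else 0)
    (hHu : ∀ i, H.mulVec (u i) = μ i • u i) {ν : ℝ} {w : Fin d → ℝ} (hw0 : w ≠ 0)
    (hw : H.mulVec w = ν • w) : ∃ i, ν = μ i ∧ ∃ c : ℝ, w = c • u i := by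
  have h1 : ∃ i, u i ⬝ᵥ w ≠ 0 := by
    by_contra! h
    apply hw0
    funext n
    have : w n = ∑ i, u i n * (u i ⬝ᵥ w) := by
      simp only [dotProduct, Finset.mul_sum]
      rw [Finset.sum_comm]
      simp only [← mul_assoc, ← Finset.sum_mul, sum_mul_comm_of_orthonormal hu]
      simp
    simp [this, h]
  obtain ⟨i, hi⟩ := h1
  have h2 : μ i * (u i ⬝ᵥ w) = ν * (u i ⬝ᵥ w) := by
    have h3 : u i ⬝ᵥ H.mulVec w = H.mulVec (u i) ⬝ᵥ w := by
      rw [Matrix.dotProduct_mulVec, ← Matrix.mulVec_transpose, hH.isSymm.eq]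
    rw [hw, hHu, dotProduct_smul, smul_dotProduct] at h3
    simpa using h3.symm
  have h4 : ν = μ i := (mul_right_cancel₀ hi h2).symm
  refine ⟨i, h4, hH.exists_smul_eq (hHu i) ?_ (h4 ▸ hw)⟩
  intro h
  simp [h] at hi

/-- The eigenvectors of a Jacobi matrix, in decreasing order of eigenvalue, alternate between the
eigenspaces of a commuting involution of Chebyshev type. -/
theorem IsJacobi.exists_eigenbasis_alternating (hH : IsJacobi H) {G : Matrix (Fin d) (Fin d) ℝ}
    (hcomm : G * H = H * G) (hGG : G * G = 1) {q : Fin d → Polynomial ℝ}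
    (hq : ∀ m, (q m).natDegree = m) {α β x : Fin d → ℝ} (hx : StrictAnti x)
    (hα : ∀ m, 0 < α m) (hβ : ∀ m, 0 < β m) (hlead : ∀ m, 0 < (q m).leadingCoeff)
    (hG : ∀ m n, G m n = α m * β n * (q m).eval (x n)) :
    ∃ (u : Fin d → Fin d → ℝ) (μ : Fin d → ℝ),
      (∀ i j, ∑ n, u i n * u j n = if i = j then 1 else 0) ∧ StrictAnti μ ∧
      (∀ i, H.mulVec (u i) = μ i • u i) ∧ (∀ i, G.mulVec (u i) = (-1 : ℝ) ^ (i : ℕ) • u i) ∧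
      ∀ (ν : ℝ) (w : Fin d → ℝ), w ≠ 0 → H.mulVec w = ν • w →
        ∃ i, ν = μ i ∧ ∃ c : ℝ, w = c • u i := by
  obtain ⟨u, μ, hu, hμ, hHu⟩ := hH.exists_eigenbasis
  have hne : ∀ i, u i ≠ 0 := by
    intro i h
    have := hu i i
    simp [h] at this
  -- `G` preserves the eigenspaces of `H`, which are lines.
  have hg : ∀ i, ∃ c : ℝ, G.mulVec (u i) = c • u i := by
    intro i
    refine hH.exists_smul_eq (hHu i) (hne i) ?_
    rw [Matrix.mulVec_mulVec, ← hcomm, ← Matrix.mulVec_mulVec, hHu, Matrix.mulVec_smul]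
  choose g hg using hg
  refine ⟨u, μ, hu, hμ, hHu, fun i => ?_, fun ν w hw0 hw =>
    hH.exists_eq_smul_of_eigenvector hu hHu hw0 hw⟩
  have hpos := neg_one_pow_mul_pos hx hu hHu hμ hH.nonneg hH.eq_zero hg hq hα hβ hlead hG i
  have hsq : g i * g i = 1 := by
    have h1 : G.mulVec (G.mulVec (u i)) = u i := by
      rw [Matrix.mulVec_mulVec, hGG, Matrix.one_mulVec]
    rw [hg, Matrix.mulVec_smul, hg, smul_smul] at h1
    by_contra hne1
    apply hne i
    have h2 : (g i * g i - 1) • u i = 0 := by rw [sub_smul, h1, one_smul, sub_self]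
    exact (smul_eq_zero.mp h2).resolve_left (sub_ne_zero.mpr hne1)
  rw [hg]
  congr 1
  rcases mul_self_eq_one_iff.mp hsq with h | h <;>
    rcases neg_one_pow_eq_or ℝ (i : ℕ) with h' | h' <;> rw [h, h'] at hpos <;> rw [h, h'] <;>
    norm_num at hpos

end Oscillation

noncomputable section

/-! ### The DFT matrix and the graph Fourier transforms of circulant graphs. -/

namespace JointFRT

variable {N : ℕ}

/-- The character `exp (-2πi m n / N)`. -/
def dftChar (m n : Fin N) : ℂ :=
  Complex.exp (-(2 * (Real.pi : ℂ) * Complex.I * ((m : ℕ) : ℂ) * ((n : ℕ) : ℂ) / (N : ℂ)))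

lemma dftMatrix_apply (m n : Fin N) :
    dftMatrix N m n = dftChar m n / ((Real.sqrt (N : ℝ) : ℝ) : ℂ) := rfl

lemma dftChar_comm (m n : Fin N) : dftChar m n = dftChar n m := by
  unfold dftChar
  congr 1
  ring

lemma dftChar_ne_zero (m n : Fin N) : dftChar m n ≠ 0 := Complex.exp_ne_zero _

lemma sqrt_mul_sqrt_natCast :
    ((Real.sqrt (N : ℝ) : ℝ) : ℂ) * ((Real.sqrt (N : ℝ) : ℝ) : ℂ) = (N : ℂ) := by
  rw [← Complex.ofReal_mul, Real.mul_self_sqrt (Nat.cast_nonneg N), Complex.ofReal_natCast]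

lemma dftMatrix_symm (m n : Fin N) : dftMatrix N m n = dftMatrix N n m := by
  rw [dftMatrix_apply, dftMatrix_apply, dftChar_comm]

section

variable [NeZero N]

lemma dftChar_zero_left (n : Fin N) : dftChar 0 n = 1 := by simp [dftChar]

lemma dftChar_zero_right (n : Fin N) : dftChar n 0 = 1 := by simp [dftChar]

lemma dftChar_add_left (a b n : Fin N) : dftChar (a + b) n = dftChar a n * dftChar b n := by
  have hN : (N : ℂ) ≠ 0 := Nat.cast_ne_zero.mpr (NeZero.ne N)
  unfold dftChar
  rw [← Complex.exp_add, Complex.exp_eq_exp_iff_exists_int]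
  -- Reducing `a + b` modulo `N` drops `(a + b) / N` copies of `N`, each of which costs `n` full
  -- turns.
  refine ⟨(((a : ℕ) + b) / N : ℕ) * (n : ℕ), ?_⟩
  have h : (((a : ℕ) : ℂ) + (b : ℕ)) = (N : ℂ) * ((((a : ℕ) + b) / N : ℕ) : ℂ) +
      (((a + b : Fin N) : ℕ) : ℂ) := by
    rw [Fin.val_add]
    exact_mod_cast (Nat.div_add_mod _ _).symm
  rw [Int.cast_mul, Int.cast_natCast, Int.cast_natCast]
  have h2 : (((a + b : Fin N) : ℕ) : ℂ) = ((a : ℕ) : ℂ) + (b : ℕ) -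
    (N : ℂ) * ((((a : ℕ) + b) / N : ℕ) : ℂ) := by rw [h]; ring
  rw [h2]
  field_simp
  ring

lemma dftChar_neg_left (a n : Fin N) : dftChar (-a) n = (dftChar a n)⁻¹ := by
  rw [← mul_eq_one_iff_eq_inv₀ (dftChar_ne_zero _ _), ← dftChar_add_left, neg_add_cancel,
    dftChar_zero_left]

lemma dftChar_add_right (a m n : Fin N) : dftChar a (m + n) = dftChar a m * dftChar a n := by
  rw [dftChar_comm, dftChar_add_left, dftChar_comm m, dftChar_comm n]

lemma star_dftChar (a n : Fin N) : star (dftChar a n) = dftChar (-a) n := by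
  rw [dftChar_neg_left, dftChar, ← Complex.exp_neg, Complex.star_def, ← Complex.exp_conj]
  congr 1
  simp only [map_neg, map_div₀, map_mul, map_ofNat, Complex.conj_ofReal, Complex.conj_I, map_natCast]
  ring

lemma dftChar_eq_one {n : Fin N} (h : dftChar 1 n = 1) : n = 0 := by
  have hN : (N : ℂ) ≠ 0 := Nat.cast_ne_zero.mpr (NeZero.ne N)
  have hn := n.2
  obtain ⟨z, hz⟩ := Complex.exp_eq_one_iff.mp h
  rcases Nat.lt_or_ge 1 N with h1 | h1
  · rw [Fin.val_one', Nat.mod_eq_of_lt h1] at hz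
    have h2 : ((n : ℕ) : ℂ) = -z * N := by
      have hpi : (2 * (Real.pi : ℂ) * Complex.I) ≠ 0 := by
        simp [Real.pi_ne_zero]
      apply mul_left_cancel₀ hpi
      field_simp at hz
      push_cast at hz
      linear_combination (-(Real.pi : ℂ) * 2 * Complex.I) * hz
    have h3 : ((n : ℕ) : ℤ) = -z * N := by exact_mod_cast h2
    have h4 : (N : ℤ) ∣ (n : ℕ) := ⟨-z, by rw [h3]; ring⟩
    have h5 : N ∣ (n : ℕ) := by exact_mod_cast h4
    exact Fin.ext (Nat.eq_zero_of_dvd_of_lt h5 hn)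
  · refine Fin.ext ?_
    simp only [Fin.val_zero]
    omega

/-- Translating the index by one multiplies the sum by `dftChar 1 n`, which differs from `1` when `n
≠ 0`. -/
lemma sum_dftChar (n : Fin N) : ∑ m : Fin N, dftChar m n = if n = 0 then (N : ℂ) else 0 := by
  split_ifs with h
  · subst h
    simp [dftChar_zero_right]
  · have h1 : dftChar 1 n * ∑ m : Fin N, dftChar m n = ∑ m : Fin N, dftChar m n := by
      rw [Finset.mul_sum]
      exact Fintype.sum_equiv (Equiv.addLeft 1) _ _ fun m => by
        rw [Equiv.coe_addLeft, dftChar_add_left]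
    by_contra h0
    exact h (dftChar_eq_one (mul_right_cancel₀ h0 (h1.trans (one_mul _).symm)))

lemma dftMatrix_mul_self (m n : Fin N) :
    (dftMatrix N * dftMatrix N) m n = if m = -n then 1 else 0 := by
  have hN : (N : ℂ) ≠ 0 := Nat.cast_ne_zero.mpr (NeZero.ne N)
  simp only [Matrix.mul_apply, dftMatrix_apply, div_mul_div_comm, sqrt_mul_sqrt_natCast]
  rw [← Finset.sum_div]
  have : ∀ l, dftChar m l * dftChar l n = dftChar l (m + n) := fun l => by
    rw [dftChar_add_right, dftChar_comm m]
  simp only [this, sum_dftChar, add_eq_zero_iff_eq_neg]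
  split_ifs <;> simp [hN]

lemma dftMatrix_mul_conjTranspose : dftMatrix N * (dftMatrix N).conjTranspose = 1 := by
  have hN : (N : ℂ) ≠ 0 := Nat.cast_ne_zero.mpr (NeZero.ne N)
  ext m n
  have h : ∀ l, dftMatrix N m l * (dftMatrix N).conjTranspose l n = dftChar l (m - n) / N := by
    intro l
    rw [Matrix.conjTranspose_apply, dftMatrix_apply, dftMatrix_apply, star_div₀, star_dftChar,
      Complex.star_def, Complex.conj_ofReal, div_mul_div_comm, sqrt_mul_sqrt_natCast,
      sub_eq_add_neg, dftChar_add_right, dftChar_comm m, dftChar_comm (-n)]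
  rw [Matrix.mul_apply]
  simp only [h]
  rw [← Finset.sum_div, sum_dftChar, Matrix.one_apply]
  simp only [sub_eq_zero]
  split_ifs <;> simp [hN]

lemma conjTranspose_mul_dftMatrix : (dftMatrix N).conjTranspose * dftMatrix N = 1 :=
  mul_eq_one_comm.mp dftMatrix_mul_conjTranspose

/-- The DFT diagonalizes circulant matrices. -/
lemma eq_conjTranspose_mul_diagonal_mul {A : Matrix (Fin N) (Fin N) ℂ} {c : Fin N → ℂ}
    (hA : ∀ m n, A m n = c (n - m)) :
    A = (dftMatrix N).conjTranspose *
      Matrix.diagonal (fun k => ∑ r, c r * dftChar (-r) k) * dftMatrix N := by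
  -- The columns of the adjoint DFT matrix are characters, hence eigenvectors of every circulant
  -- matrix.
  have h : A * (dftMatrix N).conjTranspose = (dftMatrix N).conjTranspose *
      Matrix.diagonal (fun k => ∑ r, c r * dftChar (-r) k) := by
    ext m k
    rw [Matrix.mul_diagonal, Matrix.mul_apply, Finset.mul_sum]
    refine (Fintype.sum_equiv (Equiv.addLeft m) _ _ fun r => ?_).symm
    rw [Equiv.coe_addLeft, hA, add_sub_cancel_left, Matrix.conjTranspose_apply,
      Matrix.conjTranspose_apply, dftMatrix_apply, dftMatrix_apply, star_div₀, star_div₀,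
      star_dftChar, star_dftChar, dftChar_add_right, dftChar_neg_left k r, dftChar_neg_left r,
      dftChar_comm r]
    ring
  rw [← h, Matrix.mul_assoc, conjTranspose_mul_dftMatrix, Matrix.mul_one]

lemma isUnit_det_dftMatrix : IsUnit (dftMatrix N).det :=
  (Matrix.isUnit_iff_isUnit_det _).mp
    (IsUnit.of_mul_eq_one _ dftMatrix_mul_conjTranspose)

lemma dftMatrix_inv : (dftMatrix N)⁻¹ = (dftMatrix N).conjTranspose :=
  Matrix.inv_eq_right_inv dftMatrix_mul_conjTranspose

lemma conjTranspose_dftMatrix_inv : ((dftMatrix N).conjTranspose)⁻¹ = dftMatrix N :=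
  Matrix.inv_eq_right_inv conjTranspose_mul_dftMatrix

theorem isAlgebraicGFT_dftMatrix {A : Matrix (Fin N) (Fin N) ℂ} (hA : IsDirectedCircular A) :
    IsAlgebraicGFT A (dftMatrix N) := by
  have hc : ∃ c : Fin N → ℂ, ∀ m n, A m n = c (n - m) := by
    rcases hA with h | h
    · refine ⟨fun r => if r = 1 then 1 else 0, fun m n => ?_⟩
      rw [h]
      simp only [sub_eq_iff_eq_add, add_comm]
    · refine ⟨fun r => if -r = 1 then 1 else 0, fun m n => ?_⟩
      rw [h]
      simp only [neg_sub, sub_eq_iff_eq_add, add_comm]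
  obtain ⟨c, hc⟩ := hc
  refine ⟨(dftMatrix N).conjTranspose, Matrix.diagonal fun k => ∑ r, c r * dftChar (-r) k,
    ?_, ⟨?_, ?_⟩, ?_, ?_⟩
  · rw [← dftMatrix_inv]
    exact Matrix.isUnit_nonsing_inv_det _ isUnit_det_dftMatrix
  · intro i j hij _
    exact Matrix.diagonal_apply_ne _ fun h => hij (by rw [h])
  · intro i j hij
    exact Or.inl (Matrix.diagonal_apply_ne _ fun h => by rw [h] at hij; omega)
  · rw [conjTranspose_dftMatrix_inv]
    exact eq_conjTranspose_mul_diagonal_mul hc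
  · rw [conjTranspose_dftMatrix_inv]

/-- The ring is circulant with real even weights, so its Laplacian is circulant too and the
Laplacian eigenvalues are real. -/
theorem isLaplacianGFT_dftMatrix {A : Matrix (Fin N) (Fin N) ℂ} (hA : IsRing A) :
    IsLaplacianGFT A (dftMatrix N) := by
  classical
  have hc : ∃ c : Fin N → ℝ, (∀ r, c (-r) = c r) ∧ (∀ r, 0 ≤ c r) ∧
      ∀ m n, A m n = (c (n - m) : ℂ) := by
    obtain ⟨M, rfl⟩ : ∃ M, N = M + 1 := ⟨N - 1, (Nat.succ_pred (NeZero.ne N)).symm⟩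
    -- The condition `r ≠ 0` excludes a loop in the one-vertex graph, where `1 = 0`.
    refine ⟨fun r => if r ≠ 0 ∧ (r = 1 ∨ -r = 1) then 1 else 0, fun r => ?_, fun r => ?_,
      fun m n => ?_⟩
    · simp only [neg_neg, ne_eq, neg_eq_zero, or_comm]
    · positivity
    · have hadj : (SimpleGraph.cycleGraph (M + 1)).Adj m n ↔
          n - m ≠ 0 ∧ (n - m = 1 ∨ -(n - m) = 1) := by
        rw [SimpleGraph.cycleGraph_eq_circulantGraph, SimpleGraph.circulantGraph_adj, sub_ne_zero,
          neg_sub, or_comm, ne_comm]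
        rfl
      rw [hA, SimpleGraph.adjMatrix_apply]
      simp only [hadj]
      split_ifs <;> simp
  obtain ⟨c, hneg, hpos, hc⟩ := hc
  set c' : Fin N → ℂ := fun r => (if r = 0 then ∑ l, (c l : ℂ) else 0) - c r with hc'
  have hL : ∀ m n, laplacian A m n = c' (n - m) := by
    intro m n
    rw [laplacian, Matrix.sub_apply, Matrix.diagonal_apply, hc, hc']
    congr 1
    simp only [hc, sub_eq_zero, eq_comm (a := n)]
    split_ifs with h
    · exact Fintype.sum_equiv (Equiv.subRight m) _ _ fun l => rfl
    · rfl
  have hstar : ∀ k, star (∑ r, c' r * dftChar (-r) k) = ∑ r, c' r * dftChar (-r) k := by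
    intro k
    rw [star_sum]
    refine Fintype.sum_equiv (Equiv.neg _) _ _ fun r => ?_
    rw [star_mul', star_dftChar, Equiv.neg_apply, hc']
    congr 1
    simp only [neg_eq_zero, hneg, star_sub, Complex.star_def, Complex.conj_ofReal]
    congr 1
    split_ifs <;> simp
  refine ⟨fun m n => ⟨c (n - m), hpos _, hc m n⟩, ?_, (dftMatrix N).conjTranspose, ?_,
    fun k => (∑ r, c' r * dftChar (-r) k).re, ?_, (Matrix.conjTranspose_conjTranspose _).symm⟩
  · ext m n
    rw [Matrix.transpose_apply, hc, hc, ← hneg, neg_sub]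
  · rw [Matrix.mem_unitaryGroup_iff, Matrix.star_eq_conjTranspose,
      Matrix.conjTranspose_conjTranspose, conjTranspose_mul_dftMatrix]
  · rw [Matrix.conjTranspose_conjTranspose]
    simp only [Complex.conj_eq_iff_re.mp (hstar _)]
    exact eq_conjTranspose_mul_diagonal_mul hL

end

end JointFRT

end

noncomputable section

/-! ### The DFT on even and odd vectors, and its commutation with the Hermite operator. -/

namespace JointFRT

variable {N : ℕ}

/-- The real kernel through which the DFT acts on the vectors with the parity of `k`: a cosine
transform for even `k`, and a sine transform for odd `k`. -/
def parityKernel (N k : ℕ) : Matrix (Fin N) (Fin N) ℝ :=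
  Matrix.of fun m n => if Even k then (dftMatrix N m n).re else -(dftMatrix N m n).im

lemma parityKernel_symm (k : ℕ) (m n : Fin N) : parityKernel N k m n = parityKernel N k n m := by
  simp only [parityKernel, Matrix.of_apply, dftMatrix_symm m n]

lemma dftMatrix_eq_cos_sin (m n : Fin N) :
    dftMatrix N m n = ((Real.cos (2 * Real.pi * (m : ℕ) * (n : ℕ) / N) / Real.sqrt N : ℝ) : ℂ) -
      ((Real.sin (2 * Real.pi * (m : ℕ) * (n : ℕ) / N) / Real.sqrt N : ℝ) : ℂ) * Complex.I := by
  have h : dftChar m n =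
      Complex.exp (((-(2 * Real.pi * (m : ℕ) * (n : ℕ) / N) : ℝ) : ℂ) * Complex.I) := by
    unfold dftChar
    congr 1
    push_cast
    ring
  rw [dftMatrix_apply, h, Complex.exp_mul_I, ← Complex.ofReal_cos, ← Complex.ofReal_sin,
    Real.cos_neg, Real.sin_neg]
  push_cast
  ring

lemma parityKernel_of_even {k : ℕ} (hk : Even k) (m n : Fin N) :
    parityKernel N k m n = Real.cos (2 * Real.pi * (m : ℕ) * (n : ℕ) / N) / Real.sqrt N := by
  simp only [parityKernel, Matrix.of_apply, hk, if_true]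
  rw [dftMatrix_eq_cos_sin]
  simp only [Complex.sub_re, Complex.ofReal_re, Complex.mul_re, Complex.ofReal_im, Complex.I_re,
    mul_zero, zero_mul, sub_zero]

lemma parityKernel_of_odd {k : ℕ} (hk : ¬ Even k) (m n : Fin N) :
    parityKernel N k m n = Real.sin (2 * Real.pi * (m : ℕ) * (n : ℕ) / N) / Real.sqrt N := by
  simp only [parityKernel, Matrix.of_apply, hk, if_false]
  rw [dftMatrix_eq_cos_sin]
  simp only [Complex.sub_im, Complex.ofReal_im, Complex.mul_im, Complex.ofReal_re, Complex.I_im,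
    Complex.I_re, mul_one, mul_zero, add_zero, zero_sub, neg_neg]

variable [NeZero N]

lemma cos_eq_dftChar_re (x : Fin N) :
    Real.cos (2 * Real.pi * ((x : ℕ) : ℝ) / (N : ℝ)) = (dftChar x 1).re := by
  have h : dftChar x 1 =
      Complex.exp (((-(2 * Real.pi * ((x : ℕ) : ℝ) / (N : ℝ)) : ℝ) : ℂ) * Complex.I) := by
    unfold dftChar
    congr 1
    rcases Nat.lt_or_ge 1 N with h1 | h1
    · rw [Fin.val_one', Nat.mod_eq_of_lt h1]
      push_cast
      ring
    · have hx : (x : ℕ) = 0 := by have := x.2; omega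
      simp [hx]
  rw [h, Complex.exp_ofReal_mul_I_re, Real.cos_neg]

lemma two_mul_cos_eq (x : Fin N) :
    ((2 * Real.cos (2 * Real.pi * ((x : ℕ) : ℝ) / (N : ℝ)) : ℝ) : ℂ) =
      dftChar x 1 + dftChar x (-1) := by
  rw [cos_eq_dftChar_re, dftChar_comm x (-1), ← star_dftChar, dftChar_comm 1, Complex.star_def,
    Complex.add_conj]

lemma hermiteMatrix_mulVec (v : Fin N → ℝ) (x : Fin N) :
    (hermiteMatrix N).mulVec v x =
      v (x + 1) + v (x - 1) + (2 * Real.cos (2 * Real.pi * ((x : ℕ) : ℝ) / (N : ℝ)) - 4) * v x := by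
  simp [Matrix.mulVec, dotProduct, hermiteMatrix, add_mul, Finset.sum_add_distrib]

lemma hermiteMatrix_symm : (hermiteMatrix N).IsSymm := by
  ext m n
  simp only [Matrix.transpose_apply, hermiteMatrix, Matrix.of_apply]
  have h1 : n = m - 1 ↔ m = n + 1 := by rw [eq_sub_iff_add_eq, eq_comm]
  have h2 : m = n - 1 ↔ n = m + 1 := by rw [eq_sub_iff_add_eq, eq_comm]
  simp only [h1, h2]
  by_cases h : m = n
  · subst h; rfl
  · rw [if_neg h, if_neg (Ne.symm h)]
    ring

lemma HasParity.hermiteMatrix_mulVec {k : ℕ} {v : Fin N → ℝ} (hv : HasParity k v) :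
    HasParity k ((hermiteMatrix N).mulVec v) := by
  intro n
  rw [JointFRT.hermiteMatrix_mulVec, JointFRT.hermiteMatrix_mulVec, hv n,
    show -n + 1 = -(n - 1) by abel, show -n - 1 = -(n + 1) by abel, hv, hv, cos_eq_dftChar_re,
    cos_eq_dftChar_re, ← star_dftChar, Complex.star_def, Complex.conj_re]
  ring

lemma star_dftMatrix (m n : Fin N) : star (dftMatrix N m n) = dftMatrix N (-m) n := by
  rw [dftMatrix_apply, dftMatrix_apply, star_div₀, star_dftChar, Complex.star_def,
    Complex.conj_ofReal]

lemma parityKernel_neg_left (k : ℕ) (m n : Fin N) :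
    parityKernel N k (-m) n = (-1) ^ k * parityKernel N k m n := by
  simp only [parityKernel, Matrix.of_apply, ← star_dftMatrix]
  split_ifs with h
  · simp [h.neg_one_pow]
  · simp [(Nat.not_even_iff_odd.mp h).neg_one_pow]

lemma hasParity_parityKernel_mulVec (k : ℕ) (v : Fin N → ℝ) :
    HasParity k ((parityKernel N k).mulVec v) := by
  intro n
  simp only [Matrix.mulVec, dotProduct, parityKernel_neg_left, mul_assoc, Finset.mul_sum]

/-- Conjugating the DFT of a real vector reflects the summation index. The result is therefore real
for even `k` and purely imaginary for odd `k`. -/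
lemma sum_dftMatrix_mul {k : ℕ} {v : Fin N → ℝ} (hv : HasParity k v) (m : Fin N) :
    ∑ n, dftMatrix N m n * (v n : ℂ) =
      (-Complex.I) ^ (k % 2) * ((parityKernel N k).mulVec v m : ℂ) := by
  set z := ∑ n, dftMatrix N m n * (v n : ℂ) with hz
  have h1 : star z = (-1) ^ k * z := by
    rw [hz, star_sum, Finset.mul_sum]
    refine Fintype.sum_equiv (Equiv.neg _) _ _ fun n => ?_
    have e : dftMatrix N m (-n) = star (dftMatrix N m n) := by
      rw [dftMatrix_symm, ← star_dftMatrix, dftMatrix_symm]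
    rw [star_mul', Equiv.neg_apply, hv, e, Complex.star_def, Complex.conj_ofReal]
    push_cast
    rw [mul_left_comm, ← mul_assoc ((-1 : ℂ) ^ k), ← mul_pow]
    simp
  have hre : ∑ n, (dftMatrix N m n).re * v n = z.re := by
    simp [hz, Complex.re_sum]
  have him : ∑ n, (dftMatrix N m n).im * v n = z.im := by
    simp [hz, Complex.im_sum]
  simp only [parityKernel, Matrix.mulVec, dotProduct, Matrix.of_apply]
  by_cases h : Even k
  · rw [h.neg_one_pow, one_mul] at h1
    simp only [h, if_true, hre, Nat.even_iff.mp h, pow_zero, one_mul]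
    exact (Complex.conj_eq_iff_re.mp h1).symm
  · have h' := Nat.not_even_iff_odd.mp h
    rw [h'.neg_one_pow, neg_one_mul] at h1
    simp only [h, if_false, neg_mul, Finset.sum_neg_distrib, him, Nat.odd_iff.mp h', pow_one]
    have h2 : z.re = 0 := by
      have := congrArg Complex.re h1
      simp at this
      linarith
    apply Complex.ext <;> simp [h2]

/-- The square of the DFT is the reflection, which acts by `(-1)^k`; this cancels the two factors
`(-i)^(k % 2)`. -/
lemma parityKernel_mulVec_mulVec {k : ℕ} {v : Fin N → ℝ} (hv : HasParity k v) :
    (parityKernel N k).mulVec ((parityKernel N k).mulVec v) = v := by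
  funext m
  have h1 : ∑ n, dftMatrix N m n * ∑ l, dftMatrix N n l * (v l : ℂ) = (v (-m) : ℂ) := by
    simp only [Finset.mul_sum, ← mul_assoc]
    rw [Finset.sum_comm]
    simp only [← Finset.sum_mul, ← Matrix.mul_apply, dftMatrix_mul_self, ← neg_eq_iff_eq_neg]
    simp
  simp only [sum_dftMatrix_mul hv, mul_left_comm _ ((-Complex.I) ^ (k % 2))] at h1
  rw [← Finset.mul_sum] at h1
  rw [sum_dftMatrix_mul (hasParity_parityKernel_mulVec k v), ← mul_assoc, ← mul_pow, hv] at h1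
  have h2 : (-Complex.I * -Complex.I) ^ (k % 2) = (((-1 : ℝ) ^ k : ℝ) : ℂ) := by
    rw [neg_mul_neg, Complex.I_mul_I, ← neg_one_pow_eq_pow_mod_two]
    simp
  rw [h2, Complex.ofReal_mul] at h1
  have h3 : (((-1 : ℝ) ^ k : ℝ) : ℂ) ≠ 0 := by simp
  exact_mod_cast mul_left_cancel₀ h3 h1

/-- The DFT exchanges translations and modulations, and `2 cos` is the sum of the two modulations
dual to the shifts by `±1`. -/
lemma dftMatrix_mul_hermiteMatrix :
    dftMatrix N * (hermiteMatrix N).map Complex.ofReal =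
      (hermiteMatrix N).map Complex.ofReal * dftMatrix N := by
  ext m n
  have hS : ∀ a b : Fin N, (hermiteMatrix N).map Complex.ofReal a b =
      (if b = a + 1 then 1 else 0) + (if b = a - 1 then 1 else 0) +
        (if b = a then dftChar a 1 + dftChar a (-1) - 4 else 0) := by
    intro a b
    rw [← two_mul_cos_eq]
    simp only [hermiteMatrix, Matrix.map_apply, Matrix.of_apply]
    split_ifs <;> simp
  have h1 : ∀ a b : Fin N, b = a + 1 ↔ b - 1 = a := fun a b => by rw [sub_eq_iff_eq_add]
  have h2 : ∀ a b : Fin N, b = a - 1 ↔ b + 1 = a := fun a b => by rw [eq_sub_iff_add_eq]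
  have hL : (dftMatrix N * (hermiteMatrix N).map Complex.ofReal) m n =
      dftMatrix N m (n - 1) + dftMatrix N m (n + 1) +
        dftMatrix N m n * (dftChar n 1 + dftChar n (-1) - 4) := by
    simp only [Matrix.mul_apply, hS, h1, h2, mul_add, Finset.sum_add_distrib]
    simp
  have hR : ((hermiteMatrix N).map Complex.ofReal * dftMatrix N) m n =
      dftMatrix N (m + 1) n + dftMatrix N (m - 1) n +
        (dftChar m 1 + dftChar m (-1) - 4) * dftMatrix N m n := by
    simp only [Matrix.mul_apply, hS, add_mul, Finset.sum_add_distrib]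
    simp
  rw [hL, hR]
  simp only [dftMatrix_apply, sub_eq_add_neg, dftChar_add_right, dftChar_add_left]
  rw [dftChar_comm 1 n, dftChar_comm (-1) n]
  ring

lemma parityKernel_mul_hermiteMatrix (k : ℕ) :
    parityKernel N k * hermiteMatrix N = hermiteMatrix N * parityKernel N k := by
  ext m n
  have h := congrFun (congrFun (dftMatrix_mul_hermiteMatrix (N := N)) m) n
  simp only [Matrix.mul_apply, Matrix.map_apply] at h
  have hre := congrArg Complex.re h
  have him := congrArg Complex.im h
  simp only [Complex.re_sum, Complex.im_sum, Complex.mul_re, Complex.mul_im, Complex.ofReal_re,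
    Complex.ofReal_im, mul_zero, zero_mul, sub_zero, add_zero, zero_add] at hre him
  simp only [Matrix.mul_apply, parityKernel, Matrix.of_apply]
  split_ifs
  · exact hre
  · simp only [neg_mul, mul_neg, Finset.sum_neg_distrib, him]

end JointFRT

end

noncomputable section

/-! ### Reduction to half of the cycle: Jacobi form and Chebyshev kernels. -/

namespace JointFRT

/-- The dimension of the space of vectors of length `N` with the parity of `k`. -/
def halfDim (N k : ℕ) : ℕ := if Even k then N / 2 + 1 else (N - 1) / 2

lemma add_mod_two_lt_of_halfDim {N k : ℕ} [NeZero N] (m : Fin (halfDim N k)) :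
    (m : ℕ) + k % 2 < N ∧ 2 * ((m : ℕ) + k % 2) ≤ N ∧
      (¬ Even k → 0 < (m : ℕ) + k % 2 ∧ 2 * ((m : ℕ) + k % 2) < N) := by
  have hN := NeZero.pos N
  have hm := m.2
  unfold halfDim at hm
  split_ifs at hm with h
  · rw [Nat.even_iff.mp h]
    exact ⟨by omega, by omega, fun h' => absurd h h'⟩
  · rw [Nat.odd_iff.mp (Nat.not_even_iff_odd.mp h)]
    exact ⟨by omega, by omega, fun _ => ⟨by omega, by omega⟩⟩

variable {N k : ℕ} [NeZero N]

/-- Representatives of `Fin N` modulo `n ↦ -n`, without the fixed points for odd `k`. -/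
def halfIdx (k : ℕ) (m : Fin (halfDim N k)) : Fin N :=
  ⟨m + k % 2, (add_mod_two_lt_of_halfDim m).1⟩

lemma val_halfIdx (m : Fin (halfDim N k)) : (halfIdx k m : ℕ) = m + k % 2 := rfl

lemma two_mul_halfIdx_le (m : Fin (halfDim N k)) : 2 * (halfIdx k m : ℕ) ≤ N :=
  (add_mod_two_lt_of_halfDim m).2.1

lemma halfIdx_of_odd (hk : ¬ Even k) (m : Fin (halfDim N k)) :
    0 < (halfIdx k m : ℕ) ∧ 2 * (halfIdx k m : ℕ) < N :=
  (add_mod_two_lt_of_halfDim m).2.2 hk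

lemma halfIdx_injective : Function.Injective (halfIdx (N := N) k) := by
  intro a b h
  have := congrArg Fin.val h
  rw [val_halfIdx, val_halfIdx] at this
  exact Fin.ext (by omega)

lemma fin_add_eq_zero_iff (a b : Fin N) : a + b = 0 ↔ N ∣ (a : ℕ) + b := by
  rw [Fin.ext_iff, Fin.val_add, Fin.val_zero, Nat.dvd_iff_mod_eq_zero]

/-- Two representatives are at most `N / 2` each, so their sum is a multiple of `N` only if both are
`0` or both are `N / 2`. -/
lemma eq_of_halfIdx_eq_neg {m l : Fin (halfDim N k)} (h : halfIdx k m = -halfIdx k l) : m = l := by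
  have h1 : N ∣ (halfIdx k m : ℕ) + halfIdx k l := by
    rw [← fin_add_eq_zero_iff, h, neg_add_cancel]
  have h2 := two_mul_halfIdx_le m
  have h3 := two_mul_halfIdx_le l
  have hN := NeZero.pos N
  apply halfIdx_injective
  apply Fin.ext
  obtain ⟨c, hc⟩ := h1
  rcases Nat.eq_zero_or_pos c with rfl | hc0
  · omega
  · have : N * 1 ≤ N * c := Nat.mul_le_mul_left N hc0
    omega

lemma halfIdx_ne_neg_of_odd (hk : ¬ Even k) (m : Fin (halfDim N k)) :
    halfIdx k m ≠ -halfIdx k m := by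
  intro h
  obtain ⟨h1, h2⟩ := halfIdx_of_odd hk m
  have h3 : N ∣ (halfIdx k m : ℕ) + halfIdx k m := by
    rw [← fin_add_eq_zero_iff]
    nth_rewrite 1 [h]
    rw [neg_add_cancel]
  have := Nat.le_of_dvd (by omega) h3
  omega

/-- For odd `k` the indices left out are the fixed points of the reflection, where odd vectors
vanish. -/
lemma exists_halfIdx_eq (n : Fin N) :
    (¬ Even k ∧ n = -n) ∨ ∃ m : Fin (halfDim N k), n = halfIdx k m ∨ n = -halfIdx k m := by
  have hN := NeZero.pos N
  have hn := n.2
  have hfix : N ∣ (n : ℕ) + n → n = -n := fun h =>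
    eq_neg_of_add_eq_zero_left ((fin_add_eq_zero_iff n n).mpr h)
  have hd : (Even k ∧ k % 2 = 0 ∧ halfDim N k = N / 2 + 1) ∨
      (¬ Even k ∧ k % 2 = 1 ∧ halfDim N k = (N - 1) / 2) := by
    unfold halfDim
    by_cases h : Even k
    · exact Or.inl ⟨h, Nat.even_iff.mp h, if_pos h⟩
    · exact Or.inr ⟨h, Nat.odd_iff.mp (Nat.not_even_iff_odd.mp h), if_neg h⟩
  have hpos : ∀ j : ℕ, k % 2 ≤ j → j - k % 2 < halfDim N k → (n : ℕ) = j →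
      ∃ m : Fin (halfDim N k), n = halfIdx k m ∨ n = -halfIdx k m := by
    intro j h1 h2 h3
    exact ⟨⟨j - k % 2, h2⟩, Or.inl (Fin.ext (by rw [val_halfIdx]; simp only; omega))⟩
  have hneg : ∀ j : ℕ, k % 2 ≤ j → j - k % 2 < halfDim N k → (n : ℕ) + j = N →
      ∃ m : Fin (halfDim N k), n = halfIdx k m ∨ n = -halfIdx k m := by
    intro j h1 h2 h3
    refine ⟨⟨j - k % 2, h2⟩, Or.inr (eq_neg_of_add_eq_zero_left ?_)⟩
    rw [fin_add_eq_zero_iff, val_halfIdx]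
    exact ⟨1, by simp only; omega⟩
  rcases hd with ⟨_, h1, h2⟩ | ⟨h0, h1, h2⟩
  · right
    by_cases h : 2 * (n : ℕ) ≤ N
    · exact hpos n (by omega) (by omega) rfl
    · exact hneg (N - n) (by omega) (by omega) (by omega)
  · by_cases hz : (n : ℕ) = 0
    · exact Or.inl ⟨h0, hfix (by rw [hz]; exact dvd_zero _)⟩
    · by_cases hh : 2 * (n : ℕ) = N
      · exact Or.inl ⟨h0, hfix ⟨1, by omega⟩⟩
      · right
        by_cases h : 2 * (n : ℕ) ≤ N
        · exact hpos n (by omega) (by omega) rfl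
        · exact hneg (N - n) (by omega) (by omega) (by omega)

lemma HasParity.ext_halfIdx {v w : Fin N → ℝ} (hv : HasParity k v) (hw : HasParity k w)
    (h : ∀ m : Fin (halfDim N k), v (halfIdx k m) = w (halfIdx k m)) : v = w := by
  funext n
  rcases exists_halfIdx_eq (k := k) n with ⟨hk, hn⟩ | ⟨m, hm | hm⟩
  · have h1 := hv n
    have h2 := hw n
    rw [← hn, (Nat.not_even_iff_odd.mp hk).neg_one_pow] at h1 h2
    linarith
  · rw [hm, h]
  · rw [hm, hv, hw, h]

/-- Twice the value at `halfIdx k m` of the basis vector `halfVec k m`. -/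
def halfNorm (k : ℕ) (m : Fin (halfDim N k)) : ℝ :=
  Real.sqrt (if halfIdx k m = -halfIdx k m then 4 else 2)

lemma halfNorm_pos (m : Fin (halfDim N k)) : 0 < halfNorm k m := by
  unfold halfNorm
  split_ifs <;> positivity

lemma halfNorm_mul_self (m : Fin (halfDim N k)) :
    halfNorm k m * halfNorm k m = if halfIdx k m = -halfIdx k m then 4 else 2 :=
  Real.mul_self_sqrt (by split_ifs <;> norm_num)

/-- An orthonormal basis of the vectors with the parity of `k`. -/
def halfVec (k : ℕ) (m : Fin (halfDim N k)) (n : Fin N) : ℝ :=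
  ((if n = halfIdx k m then 1 else 0) + (-1) ^ k * (if n = -halfIdx k m then 1 else 0)) /
    halfNorm k m

lemma neg_one_pow_mul_self (k : ℕ) : (-1 : ℝ) ^ k * (-1) ^ k = 1 := by
  rw [← mul_pow]
  simp

lemma hasParity_halfVec (m : Fin (halfDim N k)) : HasParity k (halfVec k m) := by
  intro n
  simp only [halfVec, neg_eq_iff_eq_neg, neg_neg]
  rw [← mul_div_assoc, mul_add, ← mul_assoc, neg_one_pow_mul_self]
  ring

lemma halfVec_self (m : Fin (halfDim N k)) : halfVec k m (halfIdx k m) = halfNorm k m / 2 := by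
  have h0 := (halfNorm_pos m).ne'
  have h := halfNorm_mul_self m
  rw [halfVec, if_pos rfl, div_eq_div_iff h0 two_ne_zero, h]
  by_cases hf : halfIdx k m = -halfIdx k m
  · have hk : Even k := by
      by_contra hk
      exact halfIdx_ne_neg_of_odd hk m hf
    rw [if_pos hf, if_pos hf, hk.neg_one_pow]
    norm_num
  · rw [if_neg hf, if_neg hf]
    norm_num

lemma halfVec_eq_zero {m : Fin (halfDim N k)} {n : Fin N} (h1 : n ≠ halfIdx k m)
    (h2 : n ≠ -halfIdx k m) : halfVec k m n = 0 := by
  simp [halfVec, h1, h2]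

lemma halfVec_of_ne {m l : Fin (halfDim N k)} (h : m ≠ l) : halfVec k m (halfIdx k l) = 0 :=
  halfVec_eq_zero (fun h' => h (halfIdx_injective h').symm)
    fun h' => h (eq_of_halfIdx_eq_neg h').symm

/-- The indices `±halfIdx k m` contribute equally by parity. The formula also holds at a fixed
point, where the two terms of `halfVec` coincide. -/
lemma sum_halfVec_mul {v : Fin N → ℝ} (hv : HasParity k v) (m : Fin (halfDim N k)) :
    ∑ n, halfVec k m n * v n = 2 / halfNorm k m * v (halfIdx k m) := by
  have h : ∀ n, halfVec k m n * v n = ((if n = halfIdx k m then v n else 0) +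
      (-1) ^ k * (if n = -halfIdx k m then v n else 0)) / halfNorm k m := by
    intro n
    unfold halfVec
    split_ifs <;> ring
  simp only [h]
  rw [← Finset.sum_div, Finset.sum_add_distrib, ← Finset.mul_sum]
  simp only [Finset.sum_ite_eq', mem_univ, if_true]
  rw [hv, ← mul_assoc, neg_one_pow_mul_self]
  ring

/-- The matrix with columns `halfVec k m`. -/
def halfMatrix (N k : ℕ) [NeZero N] : Matrix (Fin N) (Fin (halfDim N k)) ℝ :=
  Matrix.of fun n m => halfVec k m n

lemma halfMatrix_transpose_mul_self : (halfMatrix N k).transpose * halfMatrix N k = 1 := by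
  ext m l
  simp only [Matrix.mul_apply, Matrix.transpose_apply, halfMatrix, Matrix.of_apply]
  rw [sum_halfVec_mul (hasParity_halfVec l), Matrix.one_apply]
  split_ifs with h
  · subst h
    rw [halfVec_self]
    have := (halfNorm_pos m).ne'
    field_simp
  · rw [halfVec_of_ne (Ne.symm h), mul_zero]

lemma hasParity_halfMatrix_mulVec (w : Fin (halfDim N k) → ℝ) :
    HasParity k ((halfMatrix N k).mulVec w) := by
  intro n
  simp only [Matrix.mulVec, dotProduct, halfMatrix, Matrix.of_apply, hasParity_halfVec _ n,
    Finset.mul_sum, mul_assoc]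

lemma halfMatrix_mulVec_transpose_mulVec {v : Fin N → ℝ} (hv : HasParity k v) :
    (halfMatrix N k).mulVec ((halfMatrix N k).transpose.mulVec v) = v := by
  refine (hasParity_halfMatrix_mulVec _).ext_halfIdx hv fun m => ?_
  simp only [Matrix.mulVec, dotProduct, Matrix.transpose_apply, halfMatrix, Matrix.of_apply,
    sum_halfVec_mul hv]
  rw [Finset.sum_eq_single m]
  · rw [halfVec_self]
    have := (halfNorm_pos m).ne'
    field_simp
  · intro l _ hl
    rw [halfVec_of_ne hl, zero_mul]
  · simp

lemma halfMatrix_mul_transpose_mul {ι : Type*} [Fintype ι] {X : Matrix (Fin N) ι ℝ}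
    (hX : ∀ j, HasParity k fun n => X n j) :
    halfMatrix N k * ((halfMatrix N k).transpose * X) = X := by
  ext n j
  have := congrFun (halfMatrix_mulVec_transpose_mulVec (hX j)) n
  simpa [Matrix.mul_apply, Matrix.mulVec, dotProduct] using this

/-- The compression of a matrix to the vectors with the parity of `k`. -/
def halfCompress (k : ℕ) (X : Matrix (Fin N) (Fin N) ℝ) :
    Matrix (Fin (halfDim N k)) (Fin (halfDim N k)) ℝ :=
  (halfMatrix N k).transpose * (X * halfMatrix N k)

lemma halfMatrix_mul_halfCompress {X : Matrix (Fin N) (Fin N) ℝ}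
    (hX : ∀ v, HasParity k v → HasParity k (X.mulVec v)) :
    halfMatrix N k * halfCompress k X = X * halfMatrix N k :=
  halfMatrix_mul_transpose_mul fun j => hX _ (hasParity_halfVec j)

/-- The columns of `halfMatrix N k` span the vectors of this parity, so the projection between the
two factors acts trivially on what `Y` produces. -/
lemma halfCompress_mul {X Y : Matrix (Fin N) (Fin N) ℝ}
    (hY : ∀ v, HasParity k v → HasParity k (Y.mulVec v)) :
    halfCompress k X * halfCompress k Y = halfCompress k (X * Y) := by
  rw [halfCompress, Matrix.mul_assoc, Matrix.mul_assoc, halfMatrix_mul_halfCompress hY,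
    halfCompress, Matrix.mul_assoc]

lemma halfCompress_apply {X : Matrix (Fin N) (Fin N) ℝ}
    (hX : ∀ v, HasParity k v → HasParity k (X.mulVec v)) (m l : Fin (halfDim N k)) :
    halfCompress k X m l = 2 / halfNorm k m * X.mulVec (halfVec k l) (halfIdx k m) := by
  rw [← sum_halfVec_mul (hX _ (hasParity_halfVec l))]
  rfl

lemma halfCompress_parityKernel (m l : Fin (halfDim N k)) :
    halfCompress k (parityKernel N k) m l =
      2 / halfNorm k m * (2 / halfNorm k l * parityKernel N k (halfIdx k m) (halfIdx k l)) := by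
  rw [halfCompress_apply fun v _ => hasParity_parityKernel_mulVec k v]
  congr 1
  have h : HasParity k fun n => parityKernel N k (halfIdx k m) n := by
    intro n
    simp only
    rw [parityKernel_symm, parityKernel_neg_left, parityKernel_symm]
  rw [← sum_halfVec_mul h, Matrix.mulVec, dotProduct]
  exact Finset.sum_congr rfl fun n _ => mul_comm _ _

lemma halfCompress_hermiteMatrix_of_ne {m l : Fin (halfDim N k)} (h : m ≠ l) :
    halfCompress k (hermiteMatrix N) m l = 2 / halfNorm k m *
      (halfVec k l (halfIdx k m + 1) + halfVec k l (halfIdx k m - 1)) := by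
  rw [halfCompress_apply fun v hv => hv.hermiteMatrix_mulVec, hermiteMatrix_mulVec,
    halfVec_of_ne (Ne.symm h), mul_zero, add_zero]

lemma val_add_one_of_succ_lt {a : Fin N} (h : (a : ℕ) + 1 < N) : ((a + 1 : Fin N) : ℕ) = a + 1 := by
  rw [Fin.val_add, Fin.val_one', Nat.mod_eq_of_lt (show 1 < N by omega), Nat.mod_eq_of_lt h]

lemma isJacobi_halfCompress : Oscillation.IsJacobi (halfCompress k (hermiteMatrix N)) := by
  refine ⟨?_, fun i j hij => ?_, fun i j hne h1 h2 => ?_⟩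
  · rw [Matrix.IsSymm, halfCompress, Matrix.transpose_mul, Matrix.transpose_mul,
      Matrix.transpose_transpose, hermiteMatrix_symm.eq, Matrix.mul_assoc]
  · have hne : i ≠ j := fun h => by rw [h] at hij; omega
    rw [halfCompress_hermiteMatrix_of_ne hne]
    have hi := val_halfIdx i
    have hj := val_halfIdx j
    have hjN := (halfIdx k j).2
    have hsucc : halfIdx k i + 1 = halfIdx k j := by
      apply Fin.ext
      rw [val_add_one_of_succ_lt] <;> omega
    have hp : 0 < halfVec k j (halfIdx k j) := by
      rw [halfVec_self]
      exact half_pos (halfNorm_pos j)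
    -- At an end of the half cycle the other neighbour may fold back onto `±halfIdx k j`. This adds
    -- a positive term for even `k`; for odd `k` folding onto the negative would need a fixed point.
    have hn : 0 ≤ halfVec k j (halfIdx k i - 1) := by
      by_cases ha : halfIdx k i - 1 = halfIdx k j
      · rw [ha]; exact hp.le
      · by_cases hb : halfIdx k i - 1 = -halfIdx k j
        · by_cases hk : Even k
          · rw [hb, hasParity_halfVec, hk.neg_one_pow, one_mul]
            exact hp.le
          · exfalso
            apply halfIdx_ne_neg_of_odd hk i
            rw [← hsucc] at hb
            have hb' := congrArg (· + 1) hb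
            simpa using hb'
        · exact (halfVec_eq_zero ha hb).ge
    rw [hsucc]
    exact mul_pos (div_pos two_pos (halfNorm_pos i)) (by linarith)
  · rw [halfCompress_hermiteMatrix_of_ne hne]
    have hi := val_halfIdx i
    have hj := val_halfIdx j
    have hi2 := two_mul_halfIdx_le i
    have hj2 := two_mul_halfIdx_le j
    have hij : (i : ℕ) ≠ j := fun h => hne (Fin.ext h)
    have hsi := val_add_one_of_succ_lt (a := halfIdx k i) (by omega)
    have hsj := val_add_one_of_succ_lt (a := halfIdx k j) (by omega)
    have e1 : halfIdx k i + 1 ≠ halfIdx k j := fun h => by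
      have := congrArg Fin.val h
      omega
    -- Both representatives are at most `N / 2` and differ by at least two, so their sum plus one
    -- stays below `N` and nothing wraps around.
    have e2 : halfIdx k i + 1 ≠ -halfIdx k j := fun h => by
      have h3 := (fin_add_eq_zero_iff _ _).mp (eq_neg_iff_add_eq_zero.mp h)
      have := Nat.le_of_dvd (by omega) h3
      omega
    have e3 : halfIdx k i - 1 ≠ halfIdx k j := fun h => by
      have := congrArg Fin.val (sub_eq_iff_eq_add.mp h)
      omega
    have e4 : halfIdx k i - 1 ≠ -halfIdx k j := fun h => by
      have h3 : halfIdx k i + halfIdx k j = 1 := by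
        rw [sub_eq_iff_eq_add] at h
        rw [h]
        abel
      have h4 := congrArg Fin.val h3
      rw [Fin.val_add, Fin.val_one', Nat.mod_eq_of_lt (show 1 < N by omega),
        Nat.mod_eq_of_lt (by omega)] at h4
      omega
    rw [halfVec_eq_zero e1 e2, halfVec_eq_zero e3 e4, add_zero, mul_zero]

lemma halfIdx_strictAnti_cos :
    StrictAnti fun m : Fin (halfDim N k) =>
      Real.cos (2 * Real.pi * ((halfIdx k m : ℕ) : ℝ) / N) := by
  have hN : (0 : ℝ) < N := Nat.cast_pos.mpr (NeZero.pos N)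
  intro a b hab
  have hπ := Real.pi_pos
  refine Real.strictAntiOn_cos ⟨by positivity, ?_⟩ ⟨by positivity, ?_⟩ ?_
  · rw [div_le_iff₀ hN]
    have : (2 * (halfIdx k a : ℕ) : ℝ) ≤ N := by exact_mod_cast two_mul_halfIdx_le a
    nlinarith
  · rw [div_le_iff₀ hN]
    have : (2 * (halfIdx k b : ℕ) : ℝ) ≤ N := by exact_mod_cast two_mul_halfIdx_le b
    nlinarith
  · have : ((halfIdx k a : ℕ) : ℝ) < (halfIdx k b : ℕ) := by
      rw [val_halfIdx, val_halfIdx]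
      exact_mod_cast Nat.add_lt_add_right hab _
    gcongr

/-- With `θ = 2πn/N`, one has `cos (mθ) = T_m (cos θ)` and `sin ((m+1)θ) = U_m (cos θ) sin θ`. The
shift of `halfIdx` for odd `k` makes the degree equal to `m`, and `sin θ > 0` goes into the column
factor. -/
lemma halfCompress_parityKernel_chebyshev (N k : ℕ) [NeZero N] :
    ∃ (q : Fin (halfDim N k) → Polynomial ℝ) (α β : Fin (halfDim N k) → ℝ),
      (∀ m, (q m).natDegree = m) ∧ (∀ m, 0 < (q m).leadingCoeff) ∧ (∀ m, 0 < α m) ∧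
      (∀ m, 0 < β m) ∧ ∀ m l, halfCompress k (parityKernel N k) m l =
        α m * β l * (q m).eval (Real.cos (2 * Real.pi * ((halfIdx k l : ℕ) : ℝ) / N)) := by
  have hN : (0 : ℝ) < N := Nat.cast_pos.mpr (NeZero.pos N)
  have hc : ∀ m : Fin (halfDim N k), 0 < 2 / halfNorm k m := fun m =>
    div_pos two_pos (halfNorm_pos m)
  by_cases hk : Even k
  · refine ⟨fun m => Polynomial.Chebyshev.T ℝ (m : ℕ), fun m => 2 / halfNorm k m / Real.sqrt N,
      fun m => 2 / halfNorm k m, fun m => ?_, fun m => ?_, fun m => ?_, hc, fun m l => ?_⟩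
    · rw [Polynomial.Chebyshev.natDegree_T, Int.natAbs_natCast]
    · rw [Polynomial.Chebyshev.leadingCoeff_T]
      positivity
    · exact div_pos (hc m) (Real.sqrt_pos.mpr hN)
    · rw [halfCompress_parityKernel, parityKernel_of_even hk, Polynomial.Chebyshev.T_real_cos,
        val_halfIdx m, Nat.even_iff.mp hk, add_zero, Int.cast_natCast,
        show 2 * Real.pi * (m : ℕ) * (halfIdx k l : ℕ) / N =
          (m : ℕ) * (2 * Real.pi * (halfIdx k l : ℕ) / N) by ring]
      ring
  · have hs : ∀ l : Fin (halfDim N k),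
        0 < Real.sin (2 * Real.pi * ((halfIdx k l : ℕ) : ℝ) / N) := by
      intro l
      obtain ⟨h1, h2⟩ := halfIdx_of_odd hk l
      have h1' : (0 : ℝ) < (halfIdx k l : ℕ) := by exact_mod_cast h1
      have h2' : (2 * (halfIdx k l : ℕ) : ℝ) < N := by exact_mod_cast h2
      have hπ := Real.pi_pos
      refine Real.sin_pos_of_pos_of_lt_pi (by positivity) ?_
      rw [div_lt_iff₀ hN]
      nlinarith
    refine ⟨fun m => Polynomial.Chebyshev.U ℝ (m : ℕ), fun m => 2 / halfNorm k m / Real.sqrt N,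
      fun l => 2 / halfNorm k l * Real.sin (2 * Real.pi * ((halfIdx k l : ℕ) : ℝ) / N),
      fun m => ?_, fun m => ?_, fun m => ?_, fun m => mul_pos (hc m) (hs m), fun m l => ?_⟩
    · rw [Polynomial.Chebyshev.natDegree_U_natCast]
    · rw [Polynomial.Chebyshev.leadingCoeff_U_natCast]
      positivity
    · exact div_pos (hc m) (Real.sqrt_pos.mpr hN)
    · have hU := Polynomial.Chebyshev.U_real_cos
        (2 * Real.pi * ((halfIdx k l : ℕ) : ℝ) / N) (m : ℕ)
      rw [halfCompress_parityKernel, parityKernel_of_odd hk, val_halfIdx m,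
        Nat.odd_iff.mp (Nat.not_even_iff_odd.mp hk),
        show 2 * Real.pi * ((m + 1 : ℕ) : ℝ) * (halfIdx k l : ℕ) / N =
          (((m : ℕ) : ℤ) + 1) * (2 * Real.pi * (halfIdx k l : ℕ) / N) by push_cast; ring, ← hU]
      ring

/-- The eigenvectors of the Hermite-Gauss operator with a given parity, in decreasing order of
eigenvalue, are eigenvectors of the DFT with alternating signs. -/
theorem exists_parity_eigenbasis (N k : ℕ) [NeZero N] :
    ∃ (v : Fin (halfDim N k) → Fin N → ℝ) (μ : Fin (halfDim N k) → ℝ),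
      (∀ i j, ∑ n, v i n * v j n = if i = j then 1 else 0) ∧ StrictAnti μ ∧
      (∀ i, HasParity k (v i)) ∧ (∀ i, (hermiteMatrix N).mulVec (v i) = μ i • v i) ∧
      (∀ i, (parityKernel N k).mulVec (v i) = (-1 : ℝ) ^ (i : ℕ) • v i) ∧
      ∀ (ν : ℝ) (w : Fin N → ℝ), w ≠ 0 → HasParity k w → (hermiteMatrix N).mulVec w = ν • w →
        ∃ i, ν = μ i ∧ ∃ c : ℝ, w = c • v i := by
  have hS : ∀ v : Fin N → ℝ, HasParity k v → HasParity k ((hermiteMatrix N).mulVec v) :=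
    fun v hv => hv.hermiteMatrix_mulVec
  have hC : ∀ v : Fin N → ℝ, HasParity k v → HasParity k ((parityKernel N k).mulVec v) :=
    fun v _ => hasParity_parityKernel_mulVec k v
  have hcomm : halfCompress k (parityKernel N k) * halfCompress k (hermiteMatrix N) =
      halfCompress k (hermiteMatrix N) * halfCompress k (parityKernel N k) := by
    rw [halfCompress_mul hS, halfCompress_mul hC, parityKernel_mul_hermiteMatrix]
  have hinv : halfCompress k (parityKernel N k) * halfCompress k (parityKernel N k) = 1 := by
    rw [halfCompress_mul hC, halfCompress, ← halfMatrix_transpose_mul_self]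
    congr 1
    ext n j
    have := congrFun (parityKernel_mulVec_mulVec (hasParity_halfVec (N := N) (k := k) j)) n
    rw [Matrix.mulVec_mulVec] at this
    exact this
  obtain ⟨q, α, β, hq, hlead, hα, hβ, hG⟩ := halfCompress_parityKernel_chebyshev N k
  obtain ⟨u, μ, hu, hμ, hHu, hGu, hcompl⟩ :=
    (isJacobi_halfCompress (N := N) (k := k)).exists_eigenbasis_alternating hcomm hinv hq
      halfIdx_strictAnti_cos hα hβ hlead hG
  set E := halfMatrix N k with hE
  -- The eigenbasis is carried back to vectors of length `N` by the isometry `E`.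
  have hiso : ∀ w : Fin (halfDim N k) → ℝ, E.transpose.mulVec (E.mulVec w) = w := by
    intro w
    rw [Matrix.mulVec_mulVec, halfMatrix_transpose_mul_self, Matrix.one_mulVec]
  refine ⟨fun i => E.mulVec (u i), μ, fun i j => ?_, hμ, fun i => hasParity_halfMatrix_mulVec _,
    fun i => ?_, fun i => ?_, fun ν w hw0 hw hwν => ?_⟩
  · have : E.mulVec (u i) ⬝ᵥ E.mulVec (u j) = u i ⬝ᵥ u j := by
      rw [Matrix.dotProduct_mulVec, ← Matrix.mulVec_transpose, hiso]
    rw [← hu i j]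
    exact this
  · rw [Matrix.mulVec_mulVec, ← halfMatrix_mul_halfCompress hS, ← Matrix.mulVec_mulVec, hHu,
      Matrix.mulVec_smul]
  · rw [Matrix.mulVec_mulVec, ← halfMatrix_mul_halfCompress hC, ← Matrix.mulVec_mulVec, hGu,
      Matrix.mulVec_smul]
  · have hEw : E.mulVec (E.transpose.mulVec w) = w := halfMatrix_mulVec_transpose_mulVec hw
    obtain ⟨i, hi, c, hc⟩ := hcompl ν (E.transpose.mulVec w) (fun h => hw0 (by
      rw [← hEw, h, Matrix.mulVec_zero])) (by
      rw [halfCompress, ← Matrix.mulVec_mulVec, ← Matrix.mulVec_mulVec, hEw, hwν,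
        Matrix.mulVec_smul])
    refine ⟨i, hi, c, ?_⟩
    rw [← Matrix.mulVec_smul, ← hc, hEw]

end JointFRT

end

noncomputable section

/-! ### Discrete Hermite-Gaussians and fractional powers of the DFT. -/

namespace JointFRT

variable {N k : ℕ}

lemma order_mem (i : Fin N) : order N i ∈ orderSet N := by
  have hi := i.2
  rw [orderSet, Finset.mem_erase, Finset.mem_range, order]
  split_ifs with h
  · have := Nat.even_iff.mp h.1
    omega
  · rcases Nat.even_or_odd N with h1 | h1
    · have h2 := Nat.even_iff.mp h1
      have h3 : (i : ℕ) + 1 ≠ N := fun h' => h ⟨h1, h'⟩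
      omega
    · have h2 := Nat.odd_iff.mp h1
      omega

lemma order_injective : Function.Injective (order N) := by
  intro a b h
  have ha := a.2
  have hb := b.2
  unfold order at h
  apply Fin.ext
  split_ifs at h <;> omega

/-- A zero superdiagonal entry breaks every chain of ones, so all Jordan blocks have size one. -/
lemma jordanPow_diagonal (c ℓ : Fin N → ℂ) (β : ℝ) :
    jordanPow (Matrix.diagonal c) ℓ β =
      Matrix.diagonal fun i => Complex.exp ((β : ℂ) * ℓ i) := by
  ext i j
  rw [jordanPow, Matrix.of_apply]
  by_cases hij : i = j
  · subst hij
    rw [if_pos, Matrix.diagonal_apply_eq]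
    · simp
    · refine ⟨le_rfl, fun l l' hl hl' h => ?_⟩
      have h1 : (i : ℕ) ≤ l := hl
      have h2 : (l' : ℕ) ≤ i := hl'
      omega
  · rw [if_neg, Matrix.diagonal_apply_ne _ hij]
    rintro ⟨hle, h⟩
    have hlt : (i : ℕ) < j := lt_of_le_of_ne hle fun h => hij (Fin.ext h)
    have hj := j.2
    have hs := h i ⟨i + 1, by omega⟩ le_rfl (Fin.mk_le_of_le_val (by omega)) rfl
    rw [Matrix.diagonal_apply_ne _ (Fin.ne_of_val_ne (by simp))] at hs
    exact zero_ne_one hs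

variable [NeZero N]

lemma HasParity.of_mod_two_eq {k l : ℕ} (h : k % 2 = l % 2) {v : Fin N → ℝ} (hv : HasParity k v) :
    HasParity l v := by
  intro n
  rw [hv n, neg_one_pow_eq_pow_mod_two, h, ← neg_one_pow_eq_pow_mod_two]

/-- The order missing from `orderSet N` is the odd one with `k / 2` equal to the dimension of the
odd vectors, hence one too many. -/
lemma half_lt_halfDim (hk : k ∈ orderSet N) : k / 2 < halfDim N k := by
  have hN := NeZero.pos N
  rw [orderSet, Finset.mem_erase, Finset.mem_range] at hk
  unfold halfDim
  split_ifs with h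
  · omega
  · have := Nat.odd_iff.mp (Nat.not_even_iff_odd.mp h)
    omega

/-- Exactly `i` eigenvalues of this parity exceed `μ i`, so the counting condition selects `i = k /
2`. On that eigenline, unit length leaves only the sign free. -/
lemma exists_isDiscreteHermiteGaussian (hk : k ∈ orderSet N) :
    ∃ v₀ : Fin N → ℝ, IsDiscreteHermiteGaussian N k v₀ ∧
      (parityKernel N k).mulVec v₀ = (-1 : ℝ) ^ (k / 2) • v₀ ∧
      ∀ v, IsDiscreteHermiteGaussian N k v → v = v₀ ∨ v = -v₀ := by
  obtain ⟨u, μ, hu, hμ, hpar, hS, hC, hcompl⟩ := exists_parity_eigenbasis N k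
  have hne : ∀ i, u i ≠ 0 := by
    intro i h
    have := hu i i
    simp [h] at this
  have hset : ∀ i, {ν : ℝ | μ i < ν ∧ IsParityEigenvalue N k ν}.ncard = (i : ℕ) := by
    intro i
    have : {ν : ℝ | μ i < ν ∧ IsParityEigenvalue N k ν} = μ '' (Finset.Iio i : Finset _) := by
      ext ν
      simp only [Set.mem_ofPred_eq, Set.mem_image, Finset.coe_Iio, Set.mem_Iio]
      constructor
      · rintro ⟨h1, w, hw0, hw, hwν⟩
        obtain ⟨l, rfl, -⟩ := hcompl ν w hw0 hw hwν
        exact ⟨l, hμ.lt_iff_gt.mp h1, rfl⟩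
      · rintro ⟨l, hl, rfl⟩
        exact ⟨hμ hl, u l, hne l, hpar l, hS l⟩
    rw [this, Set.ncard_image_of_injective _ hμ.injective, Set.ncard_coe_finset, Fin.card_Iio]
  let j : Fin (halfDim N k) := ⟨k / 2, half_lt_halfDim hk⟩
  refine ⟨u j, ⟨?_, hpar j, μ j, hS j, hset j⟩, hC j, ?_⟩
  · simpa [sq] using hu j j
  · rintro v ⟨hv1, hvp, ν, hvν, hcard⟩
    have hv0 : v ≠ 0 := by
      rintro rfl
      simp at hv1
    obtain ⟨i, rfl, c, rfl⟩ := hcompl ν v hv0 hvp hvν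
    have hij : i = j := Fin.ext ((hset i).symm.trans hcard)
    subst hij
    have hc : c * c = 1 := by
      have h1 := hu j j
      rw [if_pos rfl] at h1
      calc c * c = c * c * ∑ n, u j n * u j n := by rw [h1, mul_one]
        _ = ∑ n, (c • u j) n ^ 2 := by
          rw [Finset.mul_sum]
          exact Finset.sum_congr rfl fun n _ => by rw [Pi.smul_apply, smul_eq_mul]; ring
        _ = 1 := hv1
    rcases mul_self_eq_one_iff.mp hc with rfl | rfl
    · exact Or.inl (one_smul _ _)
    · exact Or.inr (neg_one_smul _ _)

lemma hermiteGaussian_spec (hk : k ∈ orderSet N) :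
    IsDiscreteHermiteGaussian N k (hermiteGaussian N k) := by
  obtain ⟨v₀, h₀, -, -⟩ := exists_isDiscreteHermiteGaussian hk
  have h : ∃ v, IsDiscreteHermiteGaussian N k v := ⟨v₀, h₀⟩
  rw [hermiteGaussian, dif_pos h]
  exact h.choose_spec

theorem eq_or_eq_neg_hermiteGaussian (hk : k ∈ orderSet N) {v : Fin N → ℝ}
    (hv : IsDiscreteHermiteGaussian N k v) :
    v = hermiteGaussian N k ∨ v = -hermiteGaussian N k := by
  obtain ⟨v₀, -, -, huniq⟩ := exists_isDiscreteHermiteGaussian hk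
  rcases huniq v hv with rfl | rfl <;>
    rcases huniq _ (hermiteGaussian_spec hk) with h | h <;> rw [h] <;> simp

lemma parityKernel_mulVec_hermiteGaussian (hk : k ∈ orderSet N) :
    (parityKernel N k).mulVec (hermiteGaussian N k) =
      (-1 : ℝ) ^ (k / 2) • hermiteGaussian N k := by
  obtain ⟨v₀, -, hC, huniq⟩ := exists_isDiscreteHermiteGaussian hk
  rcases huniq _ (hermiteGaussian_spec hk) with h | h <;> rw [h]
  · exact hC
  · rw [Matrix.mulVec_neg, hC, smul_neg]

lemma exp_neg_I_mul_eq (k : ℕ) :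
    Complex.exp (-(Complex.I * ((Real.pi : ℂ) / 2) * (k : ℂ))) = (-Complex.I) ^ k := by
  rw [show -(Complex.I * ((Real.pi : ℂ) / 2) * (k : ℂ)) =
      (k : ℂ) * -((Real.pi : ℂ) / 2 * Complex.I) by ring, Complex.exp_nat_mul, Complex.exp_neg,
    Complex.exp_pi_div_two_mul_I, Complex.inv_I]

/-- The `k`-th discrete Hermite-Gaussian is an eigenvector of the DFT with eigenvalue `(-i) ^ k`. -/
theorem sum_dftMatrix_mul_hermiteGaussian (hk : k ∈ orderSet N) (m : Fin N) :
    ∑ n, dftMatrix N m n * (hermiteGaussian N k n : ℂ) =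
      (-Complex.I) ^ k * (hermiteGaussian N k m : ℂ) := by
  rw [sum_dftMatrix_mul (hermiteGaussian_spec hk).2.1, parityKernel_mulVec_hermiteGaussian hk,
    Pi.smul_apply, smul_eq_mul]
  -- The parity supplies `(-i)^(k % 2)` and the alternation supplies `(-1)^(k / 2)`.
  have h : (-Complex.I) ^ k = (-Complex.I) ^ (k % 2) * (-1) ^ (k / 2) := by
    conv_lhs => rw [← Nat.mod_add_div k 2, pow_add, pow_mul]
    simp
  rw [h]
  push_cast
  ring

/-- For equal parity, different counts of larger eigenvalues force different eigenvalues of a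
symmetric matrix. For opposite parity, the summand is odd under reflection. -/
lemma sum_hermiteGaussian_mul {l : ℕ} (hk : k ∈ orderSet N) (hl : l ∈ orderSet N) :
    ∑ n, hermiteGaussian N k n * hermiteGaussian N l n = if k = l then 1 else 0 := by
  obtain ⟨hk1, hkp, μ, hkμ, hkc⟩ := hermiteGaussian_spec hk
  obtain ⟨hl1, hlp, ν, hlν, hlc⟩ := hermiteGaussian_spec hl
  split_ifs with h
  · subst h
    simpa [sq] using hk1
  · by_cases hpar : k % 2 = l % 2
    · have hμν : μ ≠ ν := by
        rintro rfl
        have hev : ∀ x, IsParityEigenvalue N k x ↔ IsParityEigenvalue N l x := fun x =>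
          ⟨fun ⟨w, h0, hw, hx⟩ => ⟨w, h0, hw.of_mod_two_eq hpar, hx⟩,
            fun ⟨w, h0, hw, hx⟩ => ⟨w, h0, hw.of_mod_two_eq hpar.symm, hx⟩⟩
        simp only [hev] at hkc
        omega
      have h1 : hermiteGaussian N k ⬝ᵥ (hermiteMatrix N).mulVec (hermiteGaussian N l) =
          (hermiteMatrix N).mulVec (hermiteGaussian N k) ⬝ᵥ hermiteGaussian N l := by
        rw [Matrix.dotProduct_mulVec, ← Matrix.mulVec_transpose, hermiteMatrix_symm.eq]
      rw [hlν, hkμ, dotProduct_smul, smul_dotProduct, smul_eq_mul, smul_eq_mul] at h1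
      have h2 : (μ - ν) * (hermiteGaussian N k ⬝ᵥ hermiteGaussian N l) = 0 := by
        rw [sub_mul, h1, sub_self]
      exact (mul_eq_zero.mp h2).resolve_left (sub_ne_zero.mpr hμν)
    · have hsign : (-1 : ℝ) ^ k * (-1) ^ l = -1 := by
        rw [← pow_add]
        exact Odd.neg_one_pow (Nat.odd_iff.mpr (by omega))
      have h1 : ∑ n, hermiteGaussian N k n * hermiteGaussian N l n =
          ∑ n, -(hermiteGaussian N k n * hermiteGaussian N l n) := by
        refine Fintype.sum_equiv (Equiv.neg _) _ _ fun n => ?_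
        rw [Equiv.neg_apply, hkp, hlp, mul_mul_mul_comm, hsign]
        ring
      rw [Finset.sum_neg_distrib] at h1
      linarith

lemma exists_order_eq (hk : k ∈ orderSet N) : ∃ i : Fin N, order N i = k := by
  have hN := NeZero.pos N
  rw [orderSet, Finset.mem_erase, Finset.mem_range] at hk
  rcases Nat.even_or_odd N with h1 | h1
  · have h2 := Nat.even_iff.mp h1
    by_cases hkN : k = N
    · exact ⟨⟨N - 1, by omega⟩, by rw [order, if_pos ⟨h1, by simp only; omega⟩, hkN]⟩
    · exact ⟨⟨k, by omega⟩, by rw [order, if_neg (fun h => by have := h.2; simp only at this; omega)]⟩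
  · have h2 := Nat.odd_iff.mp h1
    exact ⟨⟨k, by omega⟩, by rw [order, if_neg (fun h => by have := Nat.even_iff.mp h.1; omega)]⟩

lemma sum_orderSet (f : ℕ → ℂ) : ∑ k ∈ orderSet N, f k = ∑ i : Fin N, f (order N i) :=
  (Finset.sum_bij (fun i _ => order N i) (fun i _ => order_mem i)
    (fun _ _ _ _ h => order_injective h)
    (fun _ hk => let ⟨i, hi⟩ := exists_order_eq hk; ⟨i, mem_univ i, hi⟩) fun _ _ => rfl).symm

/-- The matrix whose columns are the discrete Hermite-Gaussians. -/
def hermiteBasis (N : ℕ) [NeZero N] : Matrix (Fin N) (Fin N) ℂ :=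
  Matrix.of fun m i => (hermiteGaussian N (order N i) m : ℂ)

lemma hermiteBasis_transpose_mul : (hermiteBasis N).transpose * hermiteBasis N = 1 := by
  ext i j
  simp only [Matrix.mul_apply, Matrix.transpose_apply, hermiteBasis, Matrix.of_apply,
    Matrix.one_apply]
  have := sum_hermiteGaussian_mul (order_mem i) (order_mem j)
  simp only [order_injective.eq_iff] at this
  split_ifs at this ⊢ <;> exact_mod_cast this

lemma hermiteBasis_inv : (hermiteBasis N)⁻¹ = (hermiteBasis N).transpose :=
  Matrix.inv_eq_left_inv hermiteBasis_transpose_mul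

lemma hermiteBasis_mem_unitaryGroup : hermiteBasis N ∈ Matrix.unitaryGroup (Fin N) ℂ := by
  rw [Matrix.mem_unitaryGroup_iff', Matrix.star_eq_conjTranspose]
  have : (hermiteBasis N).conjTranspose = (hermiteBasis N).transpose := by
    ext i j
    simp [hermiteBasis]
  rw [this, hermiteBasis_transpose_mul]

/-- The logarithm of the eigenvalue of the DFT on the `i`-th discrete Hermite-Gaussian. -/
def hermiteLog (N : ℕ) (i : Fin N) : ℂ :=
  -(Complex.I * ((Real.pi : ℂ) / 2) * (order N i : ℂ))

lemma dftMatrix_eq_hermiteBasis_mul : dftMatrix N =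
    hermiteBasis N * Matrix.diagonal (fun i => Complex.exp (hermiteLog N i)) *
      (hermiteBasis N)⁻¹ := by
  have h : dftMatrix N * hermiteBasis N =
      hermiteBasis N * Matrix.diagonal (fun i => Complex.exp (hermiteLog N i)) := by
    ext m i
    rw [Matrix.mul_diagonal, hermiteLog, exp_neg_I_mul_eq, mul_comm, Matrix.mul_apply]
    exact sum_dftMatrix_mul_hermiteGaussian (order_mem i) m
  rw [← h, Matrix.mul_assoc, hermiteBasis_inv, mul_eq_one_comm.mp hermiteBasis_transpose_mul,
    Matrix.mul_one]

/-- The decomposition of the DFT in the basis of the discrete Hermite-Gaussians. -/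
def hermiteGFRTData (N : ℕ) [NeZero N] : GFRTData (dftMatrix N) where
  P := hermiteBasis N
  J := Matrix.diagonal fun i => Complex.exp (hermiteLog N i)
  ℓ := hermiteLog N
  isUnit_det := (Matrix.isUnit_iff_isUnit_det _).mp
    (IsUnit.of_mul_eq_one _ (mul_eq_one_comm.mp hermiteBasis_transpose_mul))
  isJordan := ⟨fun i j hij _ => Matrix.diagonal_apply_ne _ fun h => hij (by rw [h]),
    fun i j hij => Or.inl (Matrix.diagonal_apply_ne _ fun h => by rw [h] at hij; omega)⟩
  decomp := dftMatrix_eq_hermiteBasis_mul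
  exp_log i := (Matrix.diagonal_apply_eq (fun i => Complex.exp (hermiteLog N i)) i).symm
  log_block i j hij h := by
    rw [Matrix.diagonal_apply_ne _ fun h => by rw [h] at hij; omega] at h
    exact absurd h zero_ne_one

/-- The logarithms keep the full order `k` rather than its class modulo `4`, so `β` times each one
is exactly the DFRT exponent. -/
theorem gfrt_hermiteGFRTData (β : ℝ) : (hermiteGFRTData N).gfrt β = dfrt N β := by
  simp only [GFRTData.gfrt, hermiteGFRTData, jordanPow_diagonal]
  ext m n
  rw [hermiteBasis_inv, Matrix.mul_apply, dfrt, Matrix.of_apply, sum_orderSet]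
  refine Finset.sum_congr rfl fun i _ => ?_
  rw [Matrix.mul_diagonal, Matrix.transpose_apply, hermiteBasis, Matrix.of_apply, Matrix.of_apply,
    hermiteLog]
  congr 3
  ring

lemma mul_mul_transpose_eq_dfrt2D {N T : ℕ} [NeZero N] [NeZero T] (α β : ℝ)
    (X : Matrix (Fin N) (Fin T) ℂ) :
    dfrt N β * X * (dfrt T α).transpose = dfrt2D α β X := by
  ext p q
  simp only [Matrix.mul_apply, Matrix.transpose_apply, dfrt2D, Matrix.of_apply, Finset.sum_mul]
  rw [Finset.sum_comm]
  exact Finset.sum_congr rfl fun m _ => Finset.sum_congr rfl fun n _ => by ring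

end JointFRT

end

end

theorem mainTheorem4 (N T : ℕ) [NeZero N] [NeZero T] (A : Matrix (Fin N) (Fin N) ℂ)
    (hA : JointFRT.IsDirectedCircular A ∨ JointFRT.IsRing A) :
    -- the discrete Hermite-Gaussians of the DFRT are well defined up to sign
    (∀ M : ℕ, ∀ _ : NeZero M, ∀ k ∈ JointFRT.orderSet M,
      JointFRT.IsDiscreteHermiteGaussian M k (JointFRT.hermiteGaussian M k) ∧
      ∀ v, JointFRT.IsDiscreteHermiteGaussian M k v →
        v = JointFRT.hermiteGaussian M k ∨ v = -JointFRT.hermiteGaussian M k) ∧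
    -- the GFT can be taken to be the DFT
    (JointFRT.IsDirectedCircular A → JointFRT.IsAlgebraicGFT A (JointFRT.dftMatrix N)) ∧
    (JointFRT.IsRing A → JointFRT.IsLaplacianGFT A (JointFRT.dftMatrix N)) ∧
    -- the Hermite-Gaussians diagonalize it, and the corresponding fractional powers are the DFRT
    ∃ d : JointFRT.GFRTData (JointFRT.dftMatrix N),
      (∀ m i, d.P m i = (JointFRT.hermiteGaussian N (JointFRT.order N i) m : ℂ)) ∧
      (∀ i, d.ℓ i = -(Complex.I * ((Real.pi : ℂ) / 2) * (JointFRT.order N i : ℂ))) ∧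
      d.P ∈ Matrix.unitaryGroup (Fin N) ℂ ∧ d.J.IsDiag ∧
      (∀ β : ℝ, d.gfrt β = JointFRT.dfrt N β) ∧
      ∀ (α β : ℝ) (X : Matrix (Fin N) (Fin T) ℂ),
        d.jfrt α β X = JointFRT.dfrt N β * X * (JointFRT.dfrt T α).transpose ∧
        d.jfrt α β X = JointFRT.dfrt2D α β X := by
  refine ⟨fun M _ k hk => ⟨JointFRT.hermiteGaussian_spec hk, fun v hv =>
    JointFRT.eq_or_eq_neg_hermiteGaussian hk hv⟩, JointFRT.isAlgebraicGFT_dftMatrix,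
    JointFRT.isLaplacianGFT_dftMatrix, JointFRT.hermiteGFRTData N, fun _ _ => rfl, fun _ => rfl,
    JointFRT.hermiteBasis_mem_unitaryGroup, Matrix.isDiag_diagonal _,
    JointFRT.gfrt_hermiteGFRTData, fun α β X => ?_⟩
  have h : (JointFRT.hermiteGFRTData N).jfrt α β X =
      JointFRT.dfrt N β * X * (JointFRT.dfrt T α).transpose := by
    rw [JointFRT.GFRTData.jfrt, JointFRT.gfrt_hermiteGFRTData]
  exact ⟨h, h.trans (JointFRT.mul_mul_transpose_eq_dfrt2D α β X)⟩
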